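/- **Setting.** Let $\mathbf V$ be a finite set of random variables (observed or not), where each $V\in\mathbf V$ takes values in a measurable space with a $\sigma$-finite reference measure, and let $\mathcal D$ be a directed acyclic graph on $\mathbf V$. A family $\{f(\mathbf v\mid do(\mathbf x)):\mathbf X\subseteq\mathbf V\}$ of interventional densities with observational density $f(\mathbf v)$ (the case $\mathbf X=\emptyset$) is *consistent with* $\mathcal D$ if $f(\mathbf v)$ is an everywhere positive probability density and, for every $\mathbf X\subseteq\mathbf V$, $$f(\mathbf v\mid do(\mathbf x))=\prod_{V_i\in\mathbf V\setminus\mathbf X} f(v_i\mid \mathrm{pa}(v_i,\mathcal D))\,\mathbf 1(\mathbf X=\mathbf x).$$ A *causal model* induces a DAG $\mathcal D$ and a family of interventional densities consistent with $\mathcal D$ whose observational density $f$ is faithful to $\mathcal D$: for pairwise disjoint $\mathbf A,\mathbf B,\mathbf C$, conditional independence $\mathbf A\perp\!\!\!\perp\mathbf B\mid\mathbf C$ under $f$ implies that $\mathbf A$ and $\mathbf B$ are d-separated given $\mathbf C$ in $\mathcal D$. Equalities of densities are understood almost everywhere. Every node counts as an ancestor and a descendant of itself. A set $\mathbf A$ *has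 a causal effect on* a disjoint set $\mathbf B$ if there is a directed path in $\mathcal D$ from a node of $\mathbf A$ to a node of $\mathbf B$. For sets of variables, $\mathbf A_1<\dots<\mathbf A_m$ is a *causal ordering consistent with the model* if no node of $\mathbf A_j$ is an ancestor of a node of $\mathbf A_i$ for $i<j$. For pairwise disjoint $\mathbf X,\mathbf Y,\mathbf Z$, the set $\mathbf Z$ is an *adjustment set relative to* $(\mathbf X,\mathbf Y)$ if $$f(\mathbf y\mid do(\mathbf x))=\int f(\mathbf y\mid\mathbf x,\mathbf z)f(\mathbf z)\,d\mathbf z$$ for every family consistent with $\mathcal D$ (over all state spaces and reference measures); it is *minimal* if no proper subset of it is an adjustment set relative to $(\mathbf X,\mathbf Y)$. **Theorem 3 (R1 Combine).** Let $\mathbf X=\{X_1,\dots,X_k\}$, $k\ge 1$, $\{Y\}$ and $\mathbf W$ be pairwise disjoint sets of observed random variables in a causal model, and let $\mathbf X^N_i$ be the set of variables in $\mathbf X$ that are not descendants of $X_i$. Suppose that $\mathbf W<\mathbf X<Y$ is a causal ordering consistent with the model, and that there are $W_1,\dots,W_k\in\mathbf W$ and sets $\mathbf T_i\subseteq[\mathbf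 W\setminus\{W_1,\dots,W_k\}]\cup\mathbf X^N_i$ such that for all $i\in\{1,\dots,k\}$ 1. $W_i\not\!\perp\!\!\!\perp Y\mid\mathbf T_i$, and 2. $W_i\perp\!\!\!\perp Y\mid\mathbf T_i\cup\{X_i\}$. Then $\mathbf X$ has a causal effect on $Y$; for every $i$ there is a minimal adjustment set relative to $(X_i,Y)$ contained in $\mathbf T_i$; and for any choice of minimal adjustment sets $\mathbf Z_i\subseteq\mathbf T_i$ relative to $(X_i,Y)$, $i=1,\dots,k$, the causal effect of $\mathbf X$ on $Y$ is identified by the adjustment set $\mathbf Z:=\big(\bigcup_{i=1}^k\mathbf Z_i\big)\setminus\mathbf X$, that is, $\mathbf Z$ is an adjustment set relative to $(\mathbf X,Y)$. -/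

import Mathlib

open MeasureTheory
open scoped ENNReal

universe u w

/-- A directed acyclic graph on the node set `V`. -/
structure DAG (V : Type w) extends Digraph V where
  acyclic : ∀ v, ¬ Relation.TransGen Adj v v

namespace DAG

variable {V : Type w} (D : DAG V)

/-- `a` is an ancestor of `b` (every node is an ancestor of itself). -/
def IsAncestor (a b : V) : Prop := Relation.ReflTransGen D.Adj a b

/-- `p` is a path from `a` to `b`: a sequence of distinct nodes, successive ones adjacent. -/
structure IsPath (p : List V) (a b : V) : Prop where
  nodup : p.Nodup
  adjacent : p.IsChain (fun u v => D.Adj u v ∨ D.Adj v u)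
  head : p.head? = some a
  last : p.getLast? = some b

/-- On the consecutive nodes `a, c, b` of a path, `c` is a collider: `a → c ← b`. -/
def IsCollider (a c b : V) : Prop := D.Adj a c ∧ D.Adj b c

/-- The path `p` is open (d-connecting) given `C`: no non-collider on `p` is in `C`, and every
collider on `p` has a descendant in `C`. Endpoints are neither colliders nor non-colliders. -/
def IsOpen (p : List V) (C : Finset V) : Prop :=
  ∀ a c b, [a, c, b] <:+: p →
    (D.IsCollider a c b → ∃ z ∈ C, D.IsAncestor c z) ∧ (¬ D.IsCollider a c b → c ∉ C)

/-- `A` and `B` are d-separated given `C`: every path between them is blocked. -/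
def DSep (A B C : Finset V) : Prop :=
  ∀ a ∈ A, ∀ b ∈ B, ∀ p, D.IsPath p a b → ¬ D.IsOpen p C

/-- The list of node sets `S₁ < ⋯ < Sₘ` is a causal ordering consistent with the graph: no node of
a later set is an ancestor of a node of an earlier one. -/
def IsCausalOrdering (S : List (Finset V)) : Prop :=
  S.Pairwise fun A B => ∀ a ∈ A, ∀ b ∈ B, ¬ D.IsAncestor b a

/-- `A` has a causal effect on `B`: there is a causal (that is, directed) path from a node of `A` to
a node of `B`. This is used for disjoint `A` and `B` only. -/
def HasCausalEffect (A B : Finset V) : Prop := ∃ a ∈ A, ∃ b ∈ B, D.IsAncestor a b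

open Classical in
/-- The nodes of `S` that are not descendants of `a`. -/
noncomputable def nonDescendantsIn (S : Finset V) (a : V) : Finset V :=
  S.filter fun v => ¬ D.IsAncestor a v

open Classical in
/-- The parents of a node. -/
noncomputable def parents [Fintype V] (v : V) : Finset V :=
  Finset.univ.filter fun a => D.Adj a v

end DAG

section Densities

variable {V : Type w} [Fintype V] [DecidableEq V] {Ω : V → Type u} [∀ v, MeasurableSpace (Ω v)]

/-- The marginal density `f(v_S)`: all coordinates outside `S` are integrated out. It is a function
of the full assignment that depends on the coordinates in `S` only. -/
noncomputable def marginalDensity (μ : ∀ v, Measure (Ω v)) (f : (∀ v, Ω v) → ℝ≥0∞)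
    (S : Finset V) : (∀ v, Ω v) → ℝ≥0∞ :=
  ∫⋯∫⁻_Sᶜ, f ∂μ

/-- The conditional density `f(v_A | v_B) = f(v_A, v_B) / f(v_B)`. -/
noncomputable def condDensity (μ : ∀ v, Measure (Ω v)) (f : (∀ v, Ω v) → ℝ≥0∞)
    (A B : Finset V) : (∀ v, Ω v) → ℝ≥0∞ :=
  fun v => marginalDensity μ f (A ∪ B) v / marginalDensity μ f B v

/-- Conditional independence `(A ⟂ B | C)_f`: `f(a, b, c) f(c) = f(a, c) f(b, c)` almost everywhere. -/
def CondIndepDensity (μ : ∀ v, Measure (Ω v)) (f : (∀ v, Ω v) → ℝ≥0∞) (A B C : Finset V) : Prop :=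
  (fun v => marginalDensity μ f (A ∪ B ∪ C) v * marginalDensity μ f C v) =ᵐ[Measure.pi μ]
    fun v => marginalDensity μ f (A ∪ C) v * marginalDensity μ f (B ∪ C) v

/-- The density `f` is faithful to `D`: conditional independence implies d-separation. -/
def IsFaithful (D : DAG V) (μ : ∀ v, Measure (Ω v)) (f : (∀ v, Ω v) → ℝ≥0∞) : Prop :=
  ∀ A B C : Finset V, Disjoint A B → Disjoint A C → Disjoint B C →
    CondIndepDensity μ f A B C → D.DSep A B C

/-- A family of interventional densities. Since `f(v | do(x))` vanishes unless `v` agrees with `x` on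
the intervened set `X`, it is recorded by its values there: `F X v` is `f(v | do(x))` at `x = v_X`,
a density with respect to the reference measures of the coordinates outside `X`. In particular
`F ∅` is the observational density. -/
abbrev InterventionalFamily {V : Type w} (Ω : V → Type u) := Finset V → (∀ v, Ω v) → ℝ≥0∞

/-- `D` is a causal Bayesian network compatible with the family `F`: the observational density is a
positive probability density and every member of `F` is given by the truncated factorization
`f(v | do(x)) = ∏_{i ∉ X} f(v_i | pa(v_i))` on `v_X = x`. For `X = ∅` this is Markov compatibility. -/
structure IsCompatible (D : DAG V) (μ : ∀ v, Measure (Ω v)) (F : InterventionalFamily Ω) : Prop where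
  measurable : ∀ X, Measurable (F X)
  pos : ∀ v, 0 < F ∅ v
  lt_top : ∀ v, F ∅ v < ∞
  lintegral_eq_one : ∫⁻ v, F ∅ v ∂(Measure.pi μ) = 1
  truncated_factorization : ∀ X : Finset V,
    F X =ᵐ[Measure.pi μ] fun v => ∏ i ∈ Xᶜ, condDensity μ (F ∅) {i} (D.parents i) v

/-- The interventional density `f(y | do(x))`, as a function of the coordinates in `X ∪ Y`. -/
noncomputable def doDensity (μ : ∀ v, Measure (Ω v)) (F : InterventionalFamily Ω)
    (X Y : Finset V) : (∀ v, Ω v) → ℝ≥0∞ :=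
  ∫⋯∫⁻_(X ∪ Y)ᶜ, F X ∂μ

/-- The adjustment functional `∫ f(y | x, z) f(z) dz`, as a function of the coordinates in `X ∪ Y`. -/
noncomputable def adjustmentDensity (μ : ∀ v, Measure (Ω v)) (f : (∀ v, Ω v) → ℝ≥0∞)
    (X Y Z : Finset V) : (∀ v, Ω v) → ℝ≥0∞ :=
  ∫⋯∫⁻_Z, (fun v => condDensity μ f Y (X ∪ Z) v * marginalDensity μ f Z v) ∂μ

end Densities

/-- `Z` is an adjustment set relative to `(X, Y)` in `D`: the three sets are pairwise disjoint and
`f(y | do(x)) = ∫ f(y | x, z) f(z) dz` for every `f` consistent with `D`, over all state spaces and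
all σ-finite reference measures. -/
def IsAdjustmentSet {V : Type w} [Fintype V] [DecidableEq V] (D : DAG V) (X Y Z : Finset V) : Prop :=
  (Disjoint X Y ∧ Disjoint X Z ∧ Disjoint Y Z) ∧
    ∀ (Ω : V → Type u) [∀ v, MeasurableSpace (Ω v)] (μ : ∀ v, Measure (Ω v))
      [∀ v, SigmaFinite (μ v)] (F : InterventionalFamily Ω), IsCompatible D μ F →
        doDensity μ F X Y =ᵐ[Measure.pi μ] adjustmentDensity μ (F ∅) X Y Z

/-- A minimal adjustment set: no proper subset is an adjustment set. -/
def IsMinimalAdjustmentSet {V : Type w} [Fintype V] [DecidableEq V] (D : DAG V)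
    (X Y Z : Finset V) : Prop :=
  IsAdjustmentSet.{u} D X Y Z ∧ ∀ Z', Z' ⊂ Z → ¬ IsAdjustmentSet.{u} D X Y Z'

/-- A causal model, given by what it induces: a causal DAG over the variables (observed or not), a
family of interventional densities consistent with it, and faithfulness of the observational
density. -/
structure CausalModel {V : Type w} [Fintype V] [DecidableEq V] (Ω : V → Type u)
    [∀ v, MeasurableSpace (Ω v)] (μ : ∀ v, Measure (Ω v)) where
  graph : DAG V
  family : InterventionalFamily Ω
  compatible : IsCompatible graph μ family
  faithful : IsFaithful graph μ (family ∅)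

/-- The observational joint density of a causal model. -/
def CausalModel.density {V : Type w} [Fintype V] [DecidableEq V] {Ω : V → Type u}
    [∀ v, MeasurableSpace (Ω v)] {μ : ∀ v, Measure (Ω v)} (M : CausalModel Ω μ) :
    (∀ v, Ω v) → ℝ≥0∞ :=
  M.family ∅

/-! Separation is expressed throughout by connectedness in the moral graph of an ancestral set with
the conditioning nodes removed. Enlarging the conditioning set then only deletes nodes, as long as
the ancestral set does not grow.

Fix `i`. By the Markov property (`IsCompatible.condIndepDensity`) the dependence gives a moral
connection from `W_i` to `Y` off `T_i`; by faithfulness (`DAG.DSep.not_moralConn`) none survives the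
removal of `X_i`. So the connection enters `X_i` through a family `{c} ∪ pa(c)` with `c` equal to
`X_i` or one of its children. Neither `W_i` nor `T_i` contains descendants of `X_i`, hence `c` is an
ancestor of `Y`, and so is `X_i`. A child `c` is impossible, since its causal path to `Y` would
already connect `W_i` to `Y`. So `W_i` is connected to a parent of `X_i`, and any parent connected
to `Y` would be married to that one (`DAG.backdoor_of_separates`). Thus `T_i` blocks all back-door
connections and is an adjustment set by `isAdjustmentSet_of_not_moralConn`; a minimal one inside it
exists by finiteness.

For arbitrary minimal `Z_i` a converse is needed: an adjustment set for a single node blocks every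
back-door connection. Otherwise there is an open walk starting against an edge into the node, and a
model in which noisy parities of bits travel along this walk violates the adjustment formula
(`DAG.IsBackdoorWalk.not_isAdjustmentSet`). With soundness this shows that `Z_i ∩ An(X_i, Y)` still
adjusts, so minimality forces `Z_i ⊆ An(X_i, Y) = An(Y)`. Hence the ancestral set of `X`, `Y` and
all `Z_i` is just `An(Y)`, and passing from `Z_i` to the union adds no moral edges and only removes
nodes. No parent of any `X_i` is then connected to `Y`, and soundness applies to the union, which
lies in `W` and so contains no descendants of `X`. -/

set_option linter.unusedSectionVars false

/-! ### Moral graphs, open walks and d-separation -/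

namespace DAG

section Basic

variable {V : Type w} {D : DAG V}

lemma not_adj_self (v : V) : ¬ D.Adj v v := fun h => D.acyclic v (.single h)

lemma adj_asymm {u v : V} (h : D.Adj u v) : ¬ D.Adj v u :=
  fun h' => D.acyclic u (.tail (.single h) h')

lemma adj_ne {u v : V} (h : D.Adj u v) : u ≠ v := by
  rintro rfl
  exact not_adj_self _ h

lemma not_isAncestor_of_adj {u v : V} (h : D.Adj u v) : ¬ D.IsAncestor v u :=
  fun h' => D.acyclic u (Relation.TransGen.head' h h')

end Basic

variable {V : Type w} (D : DAG V)

open Classical in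
/-- The ancestors of the nodes of a set, the nodes themselves included. -/
noncomputable def ancestors [Fintype V] (A : Finset V) : Finset V :=
  Finset.univ.filter fun v => ∃ a ∈ A, D.IsAncestor v a

variable {D} in
lemma mem_ancestors [Fintype V] {A : Finset V} {v : V} :
    v ∈ D.ancestors A ↔ ∃ a ∈ A, D.IsAncestor v a := by
  simp [ancestors]

variable {D} in
lemma mem_ancestors_of_mem [Fintype V] {A : Finset V} {v : V} (h : v ∈ A) : v ∈ D.ancestors A :=
  mem_ancestors.2 ⟨v, h, .refl⟩

variable {D} in
lemma mem_ancestors_of_isAncestor [Fintype V] {A : Finset V} {u v : V} (h : D.IsAncestor u v)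
    (hv : v ∈ D.ancestors A) : u ∈ D.ancestors A := by
  obtain ⟨a, ha, hva⟩ := mem_ancestors.1 hv
  exact mem_ancestors.2 ⟨a, ha, h.trans hva⟩

variable {D} in
lemma ancestors_mono [Fintype V] {A B : Finset V} (h : A ⊆ B) : D.ancestors A ⊆ D.ancestors B := by
  intro v hv
  obtain ⟨a, ha, hva⟩ := mem_ancestors.1 hv
  exact mem_ancestors.2 ⟨a, h ha, hva⟩

/-- Adjacency in the moral graph of the nodes `S`, with the nodes of `C` removed: two nodes are
adjacent if they lie in a common set `{w} ∪ pa(w)` with `w ∈ S`. -/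
def MoralAdj (S C : Finset V) (u v : V) : Prop :=
  u ∉ C ∧ v ∉ C ∧ ∃ w ∈ S, (u = w ∨ D.Adj u w) ∧ (v = w ∨ D.Adj v w)

/-- Connectedness in the moral graph of `S` with `C` removed. -/
def MoralConn (S C : Finset V) : V → V → Prop := Relation.ReflTransGen (D.MoralAdj S C)

variable {D}

lemma MoralAdj.symm {S C : Finset V} {u v : V} (h : D.MoralAdj S C u v) : D.MoralAdj S C v u := by
  obtain ⟨hu, hv, w, hw, h1, h2⟩ := h
  exact ⟨hv, hu, w, hw, h2, h1⟩

lemma MoralConn.symm {S C : Finset V} {u v : V} (h : D.MoralConn S C u v) :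
    D.MoralConn S C v u :=
  haveI : Std.Symm (D.MoralAdj S C) := ⟨fun _ _ => MoralAdj.symm⟩
  symm_of (Relation.ReflTransGen (D.MoralAdj S C)) h

lemma MoralAdj.of_adj {S C : Finset V} {u v : V} (h : D.Adj u v) (hu : u ∉ C) (hv : v ∉ C)
    (hS : v ∈ S) : D.MoralAdj S C u v :=
  ⟨hu, hv, v, hS, Or.inr h, Or.inl rfl⟩

lemma MoralAdj.mono {S S' C : Finset V} (hS : S ⊆ S') {u v : V} (h : D.MoralAdj S C u v) :
    D.MoralAdj S' C u v := by
  obtain ⟨hu, hv, w, hw, h1⟩ := h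
  exact ⟨hu, hv, w, hS hw, h1⟩

lemma MoralConn.mono {S S' C : Finset V} (hS : S ⊆ S') {u v : V} (h : D.MoralConn S C u v) :
    D.MoralConn S' C u v :=
  Relation.ReflTransGen.mono (fun _ _ => MoralAdj.mono hS) _ _ h

lemma MoralConn.notMem {S C : Finset V} {u v : V} (h : D.MoralConn S C u v) (hu : u ∉ C) :
    v ∉ C := by
  rcases Relation.ReflTransGen.cases_tail h with rfl | ⟨c, -, hc⟩
  · exact hu
  · exact hc.2.1

/-- A directed path within an ancestrally closed set that avoids `C` is connected. -/
lemma MoralConn.of_isAncestor {S C : Finset V} {u v : V} (h : D.IsAncestor u v)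
    (hS : ∀ t, D.IsAncestor t v → t ∈ S) (hC : ∀ t, D.IsAncestor u t → D.IsAncestor t v → t ∉ C) :
    D.MoralConn S C u v := by
  induction h using Relation.ReflTransGen.head_induction_on with
  | refl => exact .refl
  | @head a c hac hcv ih =>
    refine .head (MoralAdj.of_adj hac ?_ ?_ (hS c hcv)) (ih fun t ht htv => hC t (.head hac ht) htv)
    · exact hC a .refl (.head hac hcv)
    · exact hC c (.single hac) hcv

/-- The states reached by walks from `x` on which the inner nodes differ from `x` and `y` and
are colliders exactly if they lie in `Z`. The Boolean tells whether the last edge points into the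
last node. Unless `out` holds, the first edge has to point into `x`. -/
inductive Reach (D : DAG V) (x y : V) (Z : Finset V) (out : Prop) : V → Bool → Prop
  | start {v : V} : D.Adj v x → Reach D x y Z out v false
  | startOut {v : V} : out → D.Adj x v → Reach D x y Z out v true
  | down {u v : V} {d : Bool} : Reach D x y Z out u d → u ∉ Z → u ≠ y → D.Adj u v → v ≠ x →
      Reach D x y Z out v true
  | up {u v : V} : Reach D x y Z out u false → u ∉ Z → u ≠ y → D.Adj v u → v ≠ x →
      Reach D x y Z out v false
  | bounce {u v : V} : Reach D x y Z out u true → u ∈ Z → u ≠ y → D.Adj v u → v ≠ x →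
      Reach D x y Z out v false

variable {x y : V} {Z : Finset V} {out : Prop}

lemma Reach.ne {v : V} {d : Bool} (h : D.Reach x y Z out v d) : v ≠ x := by
  cases h with
  | start h => exact adj_ne h
  | startOut _ h => exact (adj_ne h).symm
  | down _ _ _ _ h => exact h
  | up _ _ _ _ h => exact h
  | bounce _ _ _ _ h => exact h

lemma Reach.turn {u t : V} (hut : D.IsAncestor u t) (ht : t ∈ Z ∨ t = x ∨ t = y)
    (h : D.Reach x y Z out u true) (huZ : u ∉ Z) (huy : u ≠ y) :
    (∃ d, D.Reach x y Z out y d) ∨ D.Reach x y Z out u false := by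
  induction hut using Relation.ReflTransGen.head_induction_on with
  | refl =>
    rcases ht with h1 | h1 | h1
    · exact absurd h1 huZ
    · exact absurd h1 h.ne
    · exact absurd h1 huy
  | @head a c hac hct ih =>
    by_cases hcx : c = x
    · exact .inr (.start (hcx ▸ hac))
    have hc := h.down huZ huy hac hcx
    by_cases hcy : c = y
    · exact .inl ⟨_, hcy ▸ hc⟩
    by_cases hcZ : c ∈ Z
    · exact .inr (hc.bounce hcZ hcy hac h.ne)
    · exact (ih hc hcZ hcy).imp id fun h' => h'.up hcZ hcy hac h.ne

/-- A moral edge is an edge or a detour over a common child. Whenever the walk would turn upwards at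
a node outside `Z` that it entered from above, `Reach.turn` supplies the detour; this is why `S` has
to consist of ancestors of `x`, `y` and `Z`. -/
lemma Reach.step [Fintype V] [DecidableEq V] {S C : Finset V}
    (hS : S ⊆ D.ancestors (insert x (insert y Z)))
    (hZC : Z ⊆ C) {u v : V} {d : Bool}
    (h : D.Reach x y Z out u d) (huy : u ≠ y) (hv : v ≠ x) (huv : D.MoralAdj S C u v) :
    (∃ d, D.Reach x y Z out y d) ∨ ∃ d, D.Reach x y Z out v d := by
  have key : ∀ {c : V}, c ∈ S → D.Reach x y Z out c true → c ∉ Z → c ≠ y →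
      (∃ d, D.Reach x y Z out y d) ∨ D.Reach x y Z out c false := by
    intro c hcS hc hcZ hcy
    obtain ⟨t, ht, hct⟩ := mem_ancestors.1 (hS hcS)
    refine Reach.turn hct ?_ hc hcZ hcy
    simp only [Finset.mem_insert] at ht
    tauto
  obtain ⟨huC, hvC, w, hwS, hu, hvw⟩ := huv
  have huZ : u ∉ Z := fun h' => huC (hZC h')
  rcases hu with rfl | hu
  · rcases hvw with rfl | hvu
    · exact .inr ⟨d, h⟩
    · have : (∃ d, D.Reach x y Z out y d) ∨ D.Reach x y Z out u false := by
        cases d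
        · exact .inr h
        · exact key hwS h huZ huy
      exact this.imp id fun h' => ⟨_, h'.up huZ huy hvu hv⟩
  · rcases hvw with rfl | hvw
    · exact .inr ⟨_, h.down huZ huy hu hv⟩
    by_cases hwx : w = x
    · exact .inr ⟨_, .start (hwx ▸ hvw)⟩
    have hw := h.down huZ huy hu hwx
    by_cases hwy : w = y
    · exact .inl ⟨_, hwy ▸ hw⟩
    by_cases hwZ : w ∈ Z
    · exact .inr ⟨_, hw.bounce hwZ hwy hvw hv⟩
    · exact (key hwS hw hwZ hwy).imp id fun h' => ⟨_, h'.up hwZ hwy hvw hv⟩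

/-- A node connected to a parent of `x` without passing through `x` is reached from `x` by a walk
that starts against an edge into `x`. -/
lemma Reach.of_moralConn [Fintype V] [DecidableEq V] {S C : Finset V}
    (hS : S ⊆ D.ancestors (insert x (insert y Z))) (hZC : Z ⊆ C) (hx : x ∈ C) {a : V}
    (ha : D.Adj a x) (h : D.MoralConn S C a y) : ∃ d, D.Reach x y Z False y d := by
  suffices ∀ b, D.MoralConn S C a b →
      (∃ d, D.Reach x y Z False y d) ∨ ∃ d, D.Reach x y Z False b d by
    simpa using this y h
  intro b hb
  induction hb with
  | refl => exact .inr ⟨_, .start ha⟩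
  | @tail b c _ hbc ih =>
    rcases ih with ih | ⟨d, ih⟩
    · exact .inl ih
    by_cases hby : b = y
    · exact .inl ⟨d, hby ▸ ih⟩
    · exact ih.step hS hZC hby (fun h' => hbc.2.1 (h' ▸ hx)) hbc

/-- Nodes connected in the moral graph are reached by a walk. -/
lemma Reach.of_moralConn_out [Fintype V] [DecidableEq V] {S : Finset V}
    (hS : S ⊆ D.ancestors (insert x (insert y Z))) (hxy : x ≠ y)
    (h : D.MoralConn S Z x y) : ∃ d, D.Reach x y Z True y d := by
  suffices ∀ b, D.MoralConn S Z x b →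
      (∃ d, D.Reach x y Z True y d) ∨ b = x ∨ ∃ d, D.Reach x y Z True b d by
    rcases this y h with h | h | h
    · exact h
    · exact absurd h.symm hxy
    · exact h
  intro b hb
  induction hb with
  | refl => exact .inr (.inl rfl)
  | @tail b c _ hbc ih =>
    by_cases hcx : c = x
    · exact .inr (.inl hcx)
    rcases ih with ih | rfl | ⟨d, ih⟩
    · exact .inl ih
    · obtain ⟨hb, hc, w, hwS, hbw, hcw⟩ := hbc
      rcases hbw with rfl | hbw
      · rcases hcw with h' | hcw
        · exact absurd h' hcx
        · exact .inr (.inr ⟨_, .start hcw⟩)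
      have hw : D.Reach b y Z True w true := .startOut trivial hbw
      rcases hcw with rfl | hcw
      · exact .inr (.inr ⟨_, hw⟩)
      by_cases hwy : w = y
      · exact .inl ⟨_, hwy ▸ hw⟩
      by_cases hwZ : w ∈ Z
      · exact .inr (.inr ⟨_, hw.bounce hwZ hwy hcw hcx⟩)
      obtain ⟨t, ht, hwt⟩ := mem_ancestors.1 (hS hwS)
      have ht' : t ∈ Z ∨ t = b ∨ t = y := by
        simp only [Finset.mem_insert] at ht
        tauto
      rcases Reach.turn hwt ht' hw hwZ hwy with h' | h'
      · exact .inl h'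
      · exact .inr (.inr ⟨_, h'.up hwZ hwy hcw hcx⟩)
    · by_cases hby : b = y
      · exact .inl ⟨d, hby ▸ ih⟩
      · exact (ih.step hS subset_rfl hby hcx hbc).imp id .inr

/-- A sequence of nodes, not necessarily distinct, with successive ones adjacent, that is open
given `C`. -/
structure IsOpenWalk (D : DAG V) (p : List V) (a b : V) (C : Finset V) : Prop where
  adjacent : p.IsChain (fun u v => D.Adj u v ∨ D.Adj v u)
  head : p.head? = some a
  last : p.getLast? = some b
  isOpen : D.IsOpen p C

lemma isOpen_cons {v u t : V} {l : List V} {C : Finset V} (h : D.IsOpen (u :: t :: l) C)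
    (h' : (D.IsCollider v u t → ∃ z ∈ C, D.IsAncestor u z) ∧ (¬ D.IsCollider v u t → u ∉ C)) :
    D.IsOpen (v :: u :: t :: l) C := by
  intro a c b habc
  rcases List.infix_cons_iff.1 habc with h1 | h1
  · simp at h1
    obtain ⟨rfl, rfl, rfl⟩ := h1
    exact h'
  · exact h a c b h1

/-- The list runs backwards to `x`, so that extending the walk is a `cons`. The direction of the
latest edge is carried along because it decides whether the next inner node is a collider. -/
lemma Reach.exists_isOpenWalk {v : V} {d : Bool} (h : D.Reach x y Z out v d) :
    ∃ u l, D.IsOpenWalk (v :: u :: l) v x Z ∧ (d = true → D.Adj u v) ∧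
      (d = false → D.Adj v u) := by
  have pair : ∀ a b : V, D.IsOpen [a, b] Z := fun a b c d e h => by
    have := h.length_le
    simp at this
  have cons : ∀ {u v t : V} {l : List V}, D.IsOpenWalk (u :: t :: l) u x Z →
      (D.Adj u v ∨ D.Adj v u) →
      ((D.IsCollider v u t → ∃ z ∈ Z, D.IsAncestor u z) ∧ (¬ D.IsCollider v u t → u ∉ Z)) →
      D.IsOpenWalk (v :: u :: t :: l) v x Z := by
    intro u v t l h hadj hc
    refine ⟨List.isChain_cons_cons.2 ⟨hadj.symm, h.adjacent⟩, rfl, ?_, isOpen_cons h.isOpen hc⟩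
    rw [List.getLast?_cons_cons]
    exact h.last
  induction h with
  | @start v h =>
    exact ⟨x, [], ⟨by simp [h], rfl, rfl, pair _ _⟩, by simp, fun _ => h⟩
  | @startOut v _ h =>
    exact ⟨x, [], ⟨by simp [h], rfl, rfl, pair _ _⟩, fun _ => h, by simp⟩
  | @down u v d _ huZ _ huv _ ih =>
    obtain ⟨t, l, hw, -, -⟩ := ih
    exact ⟨u, t :: l, cons hw (.inl huv) ⟨fun hc => absurd hc.1 (adj_asymm huv), fun _ => huZ⟩,
      fun _ => huv, by simp⟩
  | @up u v _ huZ _ hvu _ ih =>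
    obtain ⟨t, l, hw, -, ht⟩ := ih
    exact ⟨u, t :: l, cons hw (.inr hvu)
      ⟨fun hc => absurd hc.2 (adj_asymm (ht rfl)), fun _ => huZ⟩, by simp, fun _ => hvu⟩
  | @bounce u v _ huZ _ hvu _ ih =>
    obtain ⟨t, l, hw, ht, -⟩ := ih
    exact ⟨u, t :: l, cons hw (.inr hvu)
      ⟨fun _ => ⟨u, huZ, .refl⟩, fun hc => absurd ⟨hvu, ht rfl⟩ hc⟩, by simp, fun _ => hvu⟩

/-- Following an open walk that starts along an edge and ends against an edge, one meets a
collider. -/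
lemma exists_isAncestor_of_isOpen {C : Finset V} {v u a b : V} {l m : List V}
    (hadj : (v :: u :: l).IsChain (fun u v => D.Adj u v ∨ D.Adj v u))
    (hopen : D.IsOpen (v :: u :: l) C) (hvu : D.Adj v u) (hl : v :: u :: l = m ++ [a, b])
    (hba : D.Adj b a) : ∃ z ∈ C, D.IsAncestor v z := by
  induction l generalizing v u m with
  | nil =>
    have : m = [] := by
      have := congrArg List.length hl
      simp at this
      simpa using this
    subst this
    simp only [List.nil_append, List.cons.injEq, and_true] at hl
    obtain ⟨rfl, rfl⟩ := hl
    exact absurd hba (adj_asymm hvu)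
  | cons t l ih =>
    rw [List.isChain_cons_cons] at hadj
    have htail : D.IsOpen (u :: t :: l) C := fun a c b h =>
      hopen a c b (h.trans (List.suffix_cons _ _).isInfix)
    have hut := (List.isChain_cons_cons.1 hadj.2).1
    rcases hut with hut | hut
    · cases m with
      | nil => simp at hl
      | cons m0 m =>
        simp only [List.cons_append, List.cons.injEq] at hl
        obtain ⟨z, hz, huz⟩ := ih hadj.2 htail hut hl.2
        exact ⟨z, hz, .head hvu huz⟩
    · obtain ⟨z, hz, huz⟩ := (hopen v u t ⟨[], l, rfl⟩).1 ⟨hvu, hut⟩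
      exact ⟨z, hz, .head hvu huz⟩

lemma isChain_of_isInfix {α : Type*} {R : α → α → Prop} {l₁ l₂ : List α} (hc : l₂.IsChain R)
    (h : l₁ <:+: l₂) : l₁.IsChain R := by
  obtain ⟨s, t, rfl⟩ := h
  exact hc.left_of_append.right_of_append

/-- Needed for cutting out loops: only a triple centred at the joint `v` can be new. -/
lemma infix_append_cons {a c b v : V} {l₁ l₃ : List V} (h : [a, c, b] <:+: l₁ ++ v :: l₃) :
    [a, c, b] <:+: l₁ ++ [v] ∨ [a, c, b] <:+: v :: l₃ ∨
      ∃ m m', l₁ = m ++ [a] ∧ c = v ∧ l₃ = b :: m' := by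
  induction l₁ with
  | nil => exact .inr (.inl h)
  | cons w l₁ ih =>
    rw [List.cons_append, List.infix_cons_iff] at h
    rcases h with h | h
    · match l₁, h with
      | [], h =>
        cases l₃ with
        | nil => simpa using h.length_le
        | cons b' l₃ =>
          simp at h
          obtain ⟨rfl, rfl, rfl⟩ := h
          exact .inr (.inr ⟨[], l₃, rfl, rfl, rfl⟩)
      | [w'], h =>
        simp at h
        obtain ⟨rfl, rfl, rfl⟩ := h
        exact .inl (List.infix_refl _)
      | w' :: w'' :: l, h =>
        simp at h
        obtain ⟨rfl, rfl, rfl⟩ := h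
        exact .inl ⟨[], l ++ [v], by simp⟩
    · rcases ih h with h | h | ⟨m, m', rfl, h2, h3⟩
      · exact .inl (h.trans (List.suffix_cons _ _).isInfix)
      · exact .inr (.inl h)
      · exact .inr (.inr ⟨w :: m, m', rfl, h2, h3⟩)

/-- A loop can be cut out of an open walk. -/
lemma IsOpenWalk.shortcut {C : Finset V} {a b v : V} {l₁ l₂ l₃ : List V}
    (h : D.IsOpenWalk (l₁ ++ v :: (l₂ ++ v :: l₃)) a b C) :
    D.IsOpenWalk (l₁ ++ v :: l₃) a b C := by
  have hpre : l₁ ++ [v] <:+: l₁ ++ v :: (l₂ ++ v :: l₃) := ⟨[], l₂ ++ v :: l₃, by simp⟩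
  have hsuf : v :: l₃ <:+: l₁ ++ v :: (l₂ ++ v :: l₃) := ⟨l₁ ++ v :: l₂, [], by simp⟩
  refine ⟨?_, ?_, ?_, ?_⟩
  · have h1 := isChain_of_isInfix h.adjacent hpre
    have h2 := isChain_of_isInfix h.adjacent hsuf
    have := List.IsChain.append_overlap (l₂ := [v]) h1 (by simpa using h2) (by simp)
    simpa using this
  · have := h.head
    cases l₁ <;> simpa using this
  · have := h.last
    simp only [List.getLast?_append, List.getLast?_cons, Option.some_or] at this ⊢
    simpa using this
  · intro a c b habc
    rcases infix_append_cons habc with h1 | h1 | ⟨m, m', rfl, rfl, rfl⟩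
    · exact h.isOpen a c b (h1.trans hpre)
    · exact h.isOpen a c b (h1.trans hsuf)
    obtain ⟨n, k, rfl⟩ : ∃ n k, l₂ = n :: k := by
      cases l₂ with
      | nil =>
        have := isChain_of_isInfix h.adjacent (l₁ := [c, c]) ⟨m ++ [a], b :: m', by simp⟩
        simp [not_adj_self] at this
      | cons n k => exact ⟨n, k, rfl⟩
    obtain ⟨k', n', hk'⟩ : ∃ k' n', n :: k = k' ++ [n'] :=
      ⟨(n :: k).dropLast, (n :: k).getLast (by simp), (List.dropLast_append_getLast _).symm⟩
    have o1 := h.isOpen a c n ⟨m, k ++ c :: b :: m', by simp⟩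
    have o2 := h.isOpen n' c b ⟨m ++ a :: c :: k', m', by rw [hk']; simp⟩
    have hloop : c :: n :: (k ++ [c]) <:+: (m ++ [a]) ++ c :: (n :: k ++ c :: b :: m') :=
      ⟨m ++ [a], b :: m', by simp⟩
    have a1 := (List.isChain_cons_cons.1 (isChain_of_isInfix h.adjacent hloop)).1
    have a2 : D.Adj n' c ∨ D.Adj c n' := by
      have := isChain_of_isInfix h.adjacent (l₁ := [n', c])
        ⟨m ++ a :: c :: k', b :: m', by rw [hk']; simp⟩
      simpa using this
    -- If `c` becomes a collider, either it was one at one of its two visits, or the loop leaves `c`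
    -- along an edge and returns against one, hence contains a collider below `c`. If it is a
    -- non-collider, an edge out of `c` made one of the visits a non-collider too.
    refine ⟨fun hc => ?_, fun hc => ?_⟩
    · rcases a1 with a1 | a1
      · rcases a2 with a2 | a2
        · exact o2.1 ⟨a2, hc.2⟩
        · refine exists_isAncestor_of_isOpen (m := c :: k') (isChain_of_isInfix h.adjacent hloop)
            (fun _ _ _ h' => h.isOpen _ _ _ (h'.trans hloop)) a1 (a := n') (b := c) ?_ a2
          rw [← List.cons_append, hk']
          simp
      · exact o1.1 ⟨hc.1, a1⟩
    · by_cases hac : D.Adj a c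
      · exact o2.2 fun h' => hc ⟨hac, h'.2⟩
      · exact o1.2 fun hcol => hac hcol.1

/-- Nodes joined by an open walk are joined by an open path. -/
lemma IsOpenWalk.exists_isPath {C : Finset V} {a b : V} {p : List V} (h : D.IsOpenWalk p a b C) :
    ∃ q, D.IsPath q a b ∧ D.IsOpen q C := by
  induction hn : p.length using Nat.strong_induction_on generalizing p with
  | _ n ih =>
    by_cases hp : p.Nodup
    · exact ⟨p, ⟨hp, h.adjacent, h.head, h.last⟩, h.isOpen⟩
    · obtain ⟨v, hv⟩ := List.exists_duplicate_iff_not_nodup.2 hp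
      obtain ⟨l₁, l₂, l₃, rfl⟩ : ∃ l₁ l₂ l₃, p = l₁ ++ v :: (l₂ ++ v :: l₃) := by
        rw [List.duplicate_iff_sublist, List.cons_sublist_iff] at hv
        obtain ⟨r₁, r₂, rfl, h₁, h₂⟩ := hv
        obtain ⟨s, t, rfl⟩ := List.append_of_mem h₁
        obtain ⟨s', t', rfl⟩ := List.append_of_mem (List.singleton_sublist.1 h₂)
        exact ⟨s, t ++ s', t', by simp⟩
      exact ih _ (by simp at hn ⊢; omega) h.shortcut rfl

lemma DSep.not_moralConn [Fintype V] [DecidableEq V] {C S : Finset V} {a b : V}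
    (h : D.DSep {a} {b} C) (hab : a ≠ b) (hS : S ⊆ D.ancestors (insert a (insert b C))) :
    ¬ D.MoralConn S C a b := by
  intro hc
  -- The search starts at `b` because the list extracted from it runs back to its start.
  rw [Finset.insert_comm] at hS
  obtain ⟨d, hd⟩ := Reach.of_moralConn_out hS hab.symm hc.symm
  obtain ⟨u, l, hw, -, -⟩ := hd.exists_isOpenWalk
  obtain ⟨q, hq, hq'⟩ := hw.exists_isPath
  exact h a (by simp) b (by simp) q hq hq'

end DAG

/-! ### Marginal densities and null sets -/

section Marginals

variable {V : Type w} [DecidableEq V] {Ω : V → Type u} [∀ v, MeasurableSpace (Ω v)]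
  {μ : ∀ v, Measure (Ω v)}

lemma DependsOn.finset_prod {ι : Type*} {f : ι → (∀ v, Ω v) → ℝ≥0∞} {s : Set V} {I : Finset ι}
    (hf : ∀ i ∈ I, DependsOn (f i) s) : DependsOn (fun v => ∏ i ∈ I, f i v) s :=
  fun _ _ h => Finset.prod_congr rfl fun i hi => hf i hi h

lemma dependsOn_lmarginal (s : Finset V) (f : (∀ v, Ω v) → ℝ≥0∞) :
    DependsOn (∫⋯∫⁻_s, f ∂μ) (s : Set V)ᶜ :=
  fun _ _ h => lmarginal_congr μ f fun i hi => h i (by simpa using hi)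

lemma DependsOn.lmarginal {s : Finset V} {t : Set V} {f : (∀ v, Ω v) → ℝ≥0∞}
    (hf : DependsOn f t) : DependsOn (∫⋯∫⁻_s, f ∂μ) t := by
  intro x y h
  refine lintegral_congr fun z => hf fun i hi => ?_
  by_cases his : i ∈ s <;> simp [Function.updateFinset, his, h i hi]

lemma lmarginal_mul_left {s : Finset V} {f g : (∀ v, Ω v) → ℝ≥0∞} (hf : Measurable f)
    (hg : DependsOn g (s : Set V)ᶜ) :
    ∫⋯∫⁻_s, (fun v => g v * f v) ∂μ = fun v => g v * (∫⋯∫⁻_s, f ∂μ) v := by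
  funext x
  have : ∀ z, g (Function.updateFinset x s z) = g x := fun z => hg fun i hi => by
    have : i ∉ s := by simpa using hi
    simp [Function.updateFinset, this]
  simp only [MeasureTheory.lmarginal, this]
  exact lintegral_const_mul _ (hf.comp measurable_updateFinset)

variable [∀ v, SigmaFinite (μ v)]

lemma lmarginal_union_mul {s t : Finset V} {f g : (∀ v, Ω v) → ℝ≥0∞} (hst : Disjoint s t)
    (hf : Measurable f) (hg : Measurable g) (hft : DependsOn f (t : Set V)ᶜ)
    (hgs : DependsOn g (s : Set V)ᶜ) :
    ∫⋯∫⁻_(s ∪ t), (fun v => f v * g v) ∂μ =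
      fun v => (∫⋯∫⁻_s, f ∂μ) v * (∫⋯∫⁻_t, g ∂μ) v := by
  rw [lmarginal_union μ (fun v => f v * g v) (hf.mul hg) hst, lmarginal_mul_left hg hft]
  have := lmarginal_mul_left (μ := μ) (s := s) hf (hgs.lmarginal (μ := μ) (s := t))
  simpa only [mul_comm] using this

lemma lmarginal_lmarginal_of_subset {s t : Finset V} {f : (∀ v, Ω v) → ℝ≥0∞} (hf : Measurable f)
    (hst : s ⊆ t) : ∫⋯∫⁻_t, f ∂μ = ∫⋯∫⁻_(t \ s), ∫⋯∫⁻_s, f ∂μ ∂μ := by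
  rw [← lmarginal_union μ f hf Finset.sdiff_disjoint, Finset.sdiff_union_of_subset hst]

variable [Fintype V]

lemma lmarginal_lmarginal_compl {f : (∀ v, Ω v) → ℝ≥0∞} (hf : Measurable f) (s : Finset V) :
    ∫⋯∫⁻_s, ∫⋯∫⁻_sᶜ, f ∂μ ∂μ = fun _ => ∫⁻ v, f v ∂(Measure.pi μ) := by
  rw [← lmarginal_union μ f hf disjoint_compl_right, Finset.union_compl, lmarginal_univ]

/-- A set whose sections over the coordinates in `s` are null is null. -/
lemma ae_of_ae_updateFinset (s : Finset V) {p : (∀ v, Ω v) → Prop}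
    (hp : MeasurableSet {v | p v})
    (h : ∀ x, ∀ᵐ z ∂(Measure.pi fun i : s => μ i), p (Function.updateFinset x s z)) :
    ∀ᵐ v ∂(Measure.pi μ), p v := by
  classical
  rw [ae_iff]
  have hm : MeasurableSet {v | ¬ p v} := hp.compl
  rcases isEmpty_or_nonempty (∀ v, Ω v) with hE | ⟨⟨x⟩⟩
  · rw [Set.eq_empty_of_isEmpty {v | ¬ p v}, measure_empty]
  have h0 : ∫⋯∫⁻_s, (Set.indicator {v | ¬ p v} 1) ∂μ = fun _ => 0 := by
    funext x
    refine lintegral_eq_zero_of_ae_eq_zero ?_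
    filter_upwards [h x] with z hz
    simp [hz]
  have hmi : Measurable (Set.indicator {v | ¬ p v} (1 : (∀ v, Ω v) → ℝ≥0∞)) :=
    measurable_one.indicator hm
  rw [← lintegral_indicator_one hm, lintegral_eq_lmarginal_univ x,
    lmarginal_lmarginal_of_subset hmi (Finset.subset_univ s), h0]
  simp [MeasureTheory.lmarginal]

/-- Almost all sections of a set of full measure have full measure. -/
lemma ae_ae_updateFinset (s : Finset V) {p : (∀ v, Ω v) → Prop}
    (h : ∀ᵐ v ∂(Measure.pi μ), p v) :
    ∀ᵐ x ∂(Measure.pi μ), ∀ᵐ z ∂(Measure.pi fun i : s => μ i),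
      p (Function.updateFinset x s z) := by
  classical
  obtain ⟨t, hpt, ht, ht0⟩ := exists_measurable_superset_of_null (ae_iff.1 h)
  have hmi : Measurable (Set.indicator t (1 : (∀ v, Ω v) → ℝ≥0∞)) := measurable_one.indicator ht
  have hsec : ∀ x, (∫⋯∫⁻_s, (t.indicator 1) ∂μ) x = 0 ↔
      ∀ᵐ z ∂(Measure.pi fun i : s => μ i), Function.updateFinset x s z ∉ t := by
    intro x
    have hc : Measurable fun z => t.indicator (1 : (∀ v, Ω v) → ℝ≥0∞)
        (Function.updateFinset x s z) := hmi.comp measurable_updateFinset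
    rw [MeasureTheory.lmarginal, lintegral_eq_zero_iff hc]
    refine Filter.eventually_congr (Filter.Eventually.of_forall fun z => ?_)
    simp
  have key : ∀ᵐ x ∂(Measure.pi μ), (∫⋯∫⁻_s, (t.indicator 1) ∂μ) x = 0 := by
    refine ae_of_ae_updateFinset sᶜ (measurableSet_eq_fun (hmi.lmarginal μ) measurable_const) ?_
    intro x
    have : (∫⋯∫⁻_sᶜ, (∫⋯∫⁻_s, (t.indicator 1) ∂μ) ∂μ) x = 0 := by
      have h1 := lmarginal_lmarginal_compl (μ := μ) hmi sᶜ
      rw [compl_compl] at h1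
      rw [h1, lintegral_indicator_one ht, ht0]
    have hc : Measurable fun z => (∫⋯∫⁻_s, (t.indicator 1) ∂μ) (Function.updateFinset x sᶜ z) :=
      (hmi.lmarginal μ).comp measurable_updateFinset
    rwa [MeasureTheory.lmarginal, lintegral_eq_zero_iff hc] at this
  filter_upwards [key] with x hx
  filter_upwards [(hsec x).1 hx] with z hz
  by_contra hp
  exact hz (hpt hp)

/-- Marginals are computed on sections, which are null sets in general; by Fubini, almost every
section sees two almost everywhere equal functions as equal. -/
lemma lmarginal_congr_ae {f g : (∀ v, Ω v) → ℝ≥0∞} (s : Finset V) (h : f =ᵐ[Measure.pi μ] g) :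
    ∫⋯∫⁻_s, f ∂μ =ᵐ[Measure.pi μ] ∫⋯∫⁻_s, g ∂μ := by
  filter_upwards [ae_ae_updateFinset s h] with x hx
  exact lintegral_congr_ae hx

lemma measurable_marginalDensity {f : (∀ v, Ω v) → ℝ≥0∞} (hf : Measurable f) (s : Finset V) :
    Measurable (marginalDensity μ f s) :=
  hf.lmarginal μ

lemma dependsOn_marginalDensity (f : (∀ v, Ω v) → ℝ≥0∞) (s : Finset V) :
    DependsOn (marginalDensity μ f s) (s : Set V) := by
  have := dependsOn_lmarginal (μ := μ) sᶜ f
  rwa [Finset.coe_compl, compl_compl] at this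

/-- Integrating the marginal over its own coordinates gives the total mass, which is finite. -/
lemma marginalDensity_lt_top {f : (∀ v, Ω v) → ℝ≥0∞} (hf : Measurable f)
    (h : ∫⁻ v, f v ∂(Measure.pi μ) ≠ ∞) (s : Finset V) :
    ∀ᵐ v ∂(Measure.pi μ), marginalDensity μ f s v < ∞ := by
  have hm := measurable_marginalDensity (μ := μ) hf s
  refine ae_of_ae_updateFinset s (measurableSet_lt hm measurable_const) fun x => ?_
  refine ae_lt_top (hm.comp measurable_updateFinset) ?_
  change (∫⋯∫⁻_s, marginalDensity μ f s ∂μ) x ≠ ∞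
  rw [marginalDensity, lmarginal_lmarginal_compl hf]
  exact h

/-- A positive function has integral zero on a section only if the section has measure zero. Then
some reference measure vanishes, and with it the total mass. -/
lemma marginalDensity_pos {f : (∀ v, Ω v) → ℝ≥0∞} (hf : Measurable f) (hpos : ∀ v, 0 < f v)
    (h : ∫⁻ v, f v ∂(Measure.pi μ) ≠ 0) (s : Finset V) (v : ∀ v, Ω v) :
    0 < marginalDensity μ f s v := by
  refine pos_iff_ne_zero.2 fun h0 => h ?_
  have hc : Measurable fun z => f (Function.updateFinset v sᶜ z) :=
    hf.comp measurable_updateFinset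
  rw [marginalDensity, MeasureTheory.lmarginal, lintegral_eq_zero_iff hc] at h0
  have hu : (Measure.pi fun i : (sᶜ : Finset V) => μ i) Set.univ = 0 := by
    have : ∀ᵐ z ∂(Measure.pi fun i : (sᶜ : Finset V) => μ i), False := by
      filter_upwards [h0] with z hz
      exact (hpos _).ne' hz
    simpa [ae_iff] using this
  rw [Measure.pi_univ, Finset.prod_eq_zero_iff] at hu
  obtain ⟨i, -, hi⟩ := hu
  have : Measure.pi μ = 0 := by
    rw [← Measure.measure_univ_eq_zero, Measure.pi_univ]
    exact Finset.prod_eq_zero (Finset.mem_univ (i : V)) hi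
  simp [this]

end Marginals

/-! ### Products of kernels: Markov property and soundness of adjustment -/

lemma ENNReal.mul_div_mul_mul_cancel {a b c d : ℝ≥0∞} (h0 : c * b ≠ 0) (h : c * b ≠ ∞) :
    a * b / (c * b) * (c * d) = a * d := by
  have hc0 : c ≠ 0 := fun h' => by simp [h'] at h0
  have hb0 : b ≠ 0 := fun h' => by simp [h'] at h0
  have hc : c ≠ ∞ := fun h' => by simp [h', hb0] at h
  have hb : b ≠ ∞ := fun h' => by simp [h', hc0] at h
  rw [ENNReal.mul_div_mul_right _ _ hb0 hb, ← mul_assoc, ENNReal.div_mul_cancel hc0 hc]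

section Kernels

variable {V : Type w} [Fintype V] [DecidableEq V] {Ω : V → Type u} [∀ v, MeasurableSpace (Ω v)]

/-- A family of conditional densities of each node given its parents, normalized everywhere. -/
structure IsKernelFamily (D : DAG V) (μ : ∀ v, Measure (Ω v)) (κ : V → (∀ v, Ω v) → ℝ≥0∞) :
    Prop where
  measurable : ∀ i, Measurable (κ i)
  dependsOn : ∀ i, DependsOn (κ i) {j | j = i ∨ D.Adj j i}
  lmarginal_eq_one : ∀ i v, (∫⋯∫⁻_{i}, κ i ∂μ) v = 1

variable {D : DAG V} {μ : ∀ v, Measure (Ω v)} [∀ v, SigmaFinite (μ v)]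
  {κ : V → (∀ v, Ω v) → ℝ≥0∞}

lemma DAG.exists_sink (D : DAG V) {B : Finset V} (hB : B.Nonempty) :
    ∃ b ∈ B, ∀ c ∈ B, ¬ D.Adj b c := by
  have : IsTrans V (fun a b => Relation.TransGen D.Adj b a) := ⟨fun a b c h1 h2 => h2.trans h1⟩
  have : Std.Irrefl (fun a b => Relation.TransGen D.Adj b a) := ⟨fun a => D.acyclic a⟩
  have wf : WellFounded (fun a b => Relation.TransGen D.Adj b a) :=
    Finite.wellFounded_of_trans_of_irrefl _
  obtain ⟨b, hb, hmin⟩ := wf.has_min (B : Set V) hB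
  exact ⟨b, hb, fun c hc hbc => hmin c hc (.single hbc)⟩

lemma IsKernelFamily.measurable_prod (hκ : IsKernelFamily D μ κ) (P : Finset V) :
    Measurable fun v => ∏ i ∈ P, κ i v :=
  Finset.measurable_prod P fun i _ => hκ.measurable i

/-- Nodes without children among the remaining ones are integrated out of a product of kernels. -/
lemma IsKernelFamily.lmarginal_prod (hκ : IsKernelFamily D μ κ) {B P : Finset V} (hBP : B ⊆ P)
    (h : ∀ v ∈ P \ B, ∀ b ∈ B, ¬ D.Adj b v) :
    ∫⋯∫⁻_B, (fun v => ∏ i ∈ P, κ i v) ∂μ = fun v => ∏ i ∈ P \ B, κ i v := by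
  induction hn : B.card generalizing B P with
  | zero =>
    rw [Finset.card_eq_zero] at hn
    simp [hn]
  | succ n ih =>
    have hne : B.Nonempty := Finset.card_pos.1 (by omega)
    obtain ⟨b, hb, hsink⟩ := D.exists_sink hne
    have hbP := hBP hb
    have hset : P.erase b \ B.erase b = P \ B := by
      ext j
      simp only [Finset.mem_sdiff, Finset.mem_erase]
      by_cases hj : j = b
      · simp [hj, hb]
      · simp [hj]
    -- The sink `b` of `B` has no child in `P` at all, so its coordinate occurs in its own kernel
    -- only.
    have hone : ∫⋯∫⁻_{b}, (fun v => ∏ i ∈ P, κ i v) ∂μ = fun v => ∏ i ∈ P.erase b, κ i v := by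
      have : (fun v => ∏ i ∈ P, κ i v) = fun v => (∏ i ∈ P.erase b, κ i v) * κ b v := by
        funext v
        rw [Finset.prod_erase_mul _ _ hbP]
      rw [this, lmarginal_mul_left (hκ.measurable b)]
      · funext v
        rw [hκ.lmarginal_eq_one, mul_one]
      · refine DependsOn.finset_prod fun i hi => (hκ.dependsOn i).mono ?_
        intro j hj
        simp only [Finset.coe_singleton, Set.mem_compl_iff, Set.mem_singleton_iff]
        rintro rfl
        rw [Finset.mem_erase] at hi
        rcases hj with rfl | hj
        · exact hi.1 rfl
        · by_cases hiB : i ∈ B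
          · exact hsink i hiB hj
          · exact h i (Finset.mem_sdiff.2 ⟨hi.2, hiB⟩) j hb hj
    rw [lmarginal_lmarginal_of_subset (hκ.measurable_prod P) (Finset.singleton_subset_iff.2 hb),
      hone, Finset.sdiff_singleton_eq_erase, ih (Finset.erase_subset_erase b hBP)]
    · rw [hset]
    · intro v hv c hc
      rw [hset] at hv
      exact h v hv c (Finset.mem_of_mem_erase hc)
    · rw [Finset.card_erase_of_mem hb, hn]
      rfl

lemma IsKernelFamily.lintegral_prod (hκ : IsKernelFamily D μ κ) (hne : Nonempty (∀ v, Ω v)) :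
    ∫⁻ v, ∏ i, κ i v ∂(Measure.pi μ) = 1 := by
  obtain ⟨x⟩ := hne
  rw [lintegral_eq_lmarginal_univ x, hκ.lmarginal_prod subset_rfl (by simp)]
  simp

/-- A compatible family is given by a family of kernels, up to null sets. -/
lemma IsCompatible.exists_kernel {F : InterventionalFamily Ω} (hF : IsCompatible D μ F) :
    ∃ κ, IsKernelFamily D μ κ ∧ ∀ X, F X =ᵐ[Measure.pi μ] fun v => ∏ i ∈ Xᶜ, κ i v := by
  classical
  set m := marginalDensity μ (F ∅) with hm
  have hmm : ∀ s, Measurable (m s) := measurable_marginalDensity (hF.measurable ∅)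
  have hmd : ∀ s : Finset V, DependsOn (m s) (s : Set V) := dependsOn_marginalDensity (F ∅)
  have hpos : ∀ s v, 0 < m s v :=
    marginalDensity_pos (hF.measurable ∅) hF.pos (by simp [hF.lintegral_eq_one])
  have hint : ∀ i (s : Finset V) v, i ∉ s → (∫⋯∫⁻_{i}, m ({i} ∪ s) ∂μ) v = m s v := by
    intro i s v hi
    rw [hm, marginalDensity, marginalDensity,
      ← lmarginal_union μ _ (hF.measurable ∅) (by simp)]
    congr 2
    ext j
    simp only [Finset.mem_union, Finset.mem_singleton, Finset.mem_compl]
    by_cases hj : j = i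
    · simp [hj, hi]
    · simp [hj]
  have hmempty : ∀ v, m ∅ v = 1 := fun v => by
    simp [hm, marginalDensity, hF.lintegral_eq_one]
  -- Where the marginal of the parents is infinite, the quotient is not normalized. On this null set
  -- the marginal of `i` alone is used, which has mass one. The case distinction depends on the
  -- parents only, so integrating over `i` does not mix the cases.
  let κ : V → (∀ v, Ω v) → ℝ≥0∞ := fun i v =>
    if m (D.parents i) v < ∞ then condDensity μ (F ∅) {i} (D.parents i) v else m {i} v
  have hκ_apply : ∀ i v, κ i v = if m (D.parents i) v < ∞ then
      m ({i} ∪ D.parents i) v / m (D.parents i) v else m {i} v := fun i v => rfl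
  have hipa : ∀ i, i ∉ D.parents i := fun i => by simp [DAG.parents, DAG.not_adj_self]
  refine ⟨κ, ⟨fun i => ?_, fun i x y h => ?_, fun i v => ?_⟩, fun X => ?_⟩
  · exact Measurable.ite (measurableSet_lt (hmm _) measurable_const) ((hmm _).div (hmm _)) (hmm _)
  · have h1 : m (D.parents i) x = m (D.parents i) y :=
      hmd _ fun j hj => h j (.inr (by simpa [DAG.parents] using hj))
    have h2 : m ({i} ∪ D.parents i) x = m ({i} ∪ D.parents i) y :=
      hmd _ fun j hj => h j (by simpa [DAG.parents] using hj)
    have h3 : m {i} x = m {i} y := hmd _ fun j hj => h j (.inl (by simpa using hj))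
    rw [hκ_apply, hκ_apply, h1, h2, h3]
  · rw [lmarginal_singleton]
    have hpa : ∀ z, m (D.parents i) (Function.update v i z) = m (D.parents i) v := fun z =>
      hmd _ fun j hj => Function.update_of_ne (by rintro rfl; exact hipa j hj) _ _
    simp only [hκ_apply, hpa]
    by_cases hlt : m (D.parents i) v < ∞
    · simp only [hlt, if_true, div_eq_mul_inv]
      have hc : Measurable fun z => m ({i} ∪ D.parents i) (Function.update v i z) :=
        (hmm _).comp (measurable_update v)
      rw [lintegral_mul_const _ hc]
      have := hint i _ v (hipa i)
      rw [lmarginal_singleton] at this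
      rw [show ∫⁻ z, m ({i} ∪ D.parents i) (Function.update v i z) ∂μ i = _ from this]
      exact ENNReal.mul_inv_cancel (hpos _ _).ne' hlt.ne
    · simp only [hlt, if_false]
      have := hint i ∅ v (by simp)
      rw [lmarginal_singleton, hmempty, Finset.union_empty] at this
      exact this
  · have hlt : ∀ᵐ v ∂(Measure.pi μ), ∀ i, m (D.parents i) v < ∞ := by
      rw [ae_all_iff]
      exact fun i => marginalDensity_lt_top (hF.measurable ∅) (by simp [hF.lintegral_eq_one]) _
    filter_upwards [hF.truncated_factorization X, hlt] with v hv hv'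
    rw [hv]
    exact Finset.prod_congr rfl fun i _ => (if_pos (hv' i)).symm

/-- The marginal density of an ancestrally closed set is the product of its kernels. -/
lemma IsKernelFamily.lmarginal_compl (hκ : IsKernelFamily D μ κ) {S X : Finset V} (hXS : X ⊆ S)
    (hS : ∀ v ∈ S, ∀ u, D.Adj u v → u ∈ S) :
    ∫⋯∫⁻_Sᶜ, (fun v => ∏ i ∈ Xᶜ, κ i v) ∂μ = fun v => ∏ i ∈ S \ X, κ i v := by
  have hset : Xᶜ \ Sᶜ = S \ X := by
    ext j
    simp only [Finset.mem_sdiff, Finset.mem_compl, not_not]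
    tauto
  rw [hκ.lmarginal_prod (Finset.compl_subset_compl.2 hXS), hset]
  intro v hv b hb hbv
  rw [hset, Finset.mem_sdiff] at hv
  exact Finset.mem_compl.1 hb (hS v hv.1 b hbv)

lemma IsKernelFamily.lmarginal_compl_of_subset (hκ : IsKernelFamily D μ κ) {S X A : Finset V}
    (hXS : X ⊆ S) (hA : A ⊆ S) (hS : ∀ v ∈ S, ∀ u, D.Adj u v → u ∈ S) :
    ∫⋯∫⁻_Aᶜ, (fun v => ∏ i ∈ Xᶜ, κ i v) ∂μ =
      ∫⋯∫⁻_(S \ A), (fun v => ∏ i ∈ S \ X, κ i v) ∂μ := by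
  rw [lmarginal_lmarginal_of_subset (hκ.measurable_prod _) (Finset.compl_subset_compl.2 hA),
    hκ.lmarginal_compl hXS hS]
  congr 1
  ext j
  simp only [Finset.mem_sdiff, Finset.mem_compl, not_not]
  tauto

lemma DAG.ancestors_closed {A : Finset V} :
    ∀ v ∈ D.ancestors A, ∀ u, D.Adj u v → u ∈ D.ancestors A :=
  fun _ hv _ huv => DAG.mem_ancestors_of_isAncestor (.single huv) hv

open Classical in
/-- The nodes connected to `y` in a moral graph. -/
noncomputable def DAG.moralComponent (D : DAG V) (S C : Finset V) (y : V) : Finset V :=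
  Finset.univ.filter fun u => D.MoralConn S C y u

lemma DAG.mem_moralComponent {S C : Finset V} {y u : V} :
    u ∈ D.moralComponent S C y ↔ D.MoralConn S C y u := by
  simp [DAG.moralComponent]

open Classical in
/-- The nodes of `P` that lie in `U` or have a parent there. -/
noncomputable def DAG.touching (D : DAG V) (P U : Finset V) : Finset V :=
  P.filter fun v => ∃ u ∈ U, u = v ∨ D.Adj u v

/-- The factors of a product of kernels separate along a component of the moral graph. -/
lemma IsKernelFamily.lmarginal_separate (hκ : IsKernelFamily D μ κ) {S C P B : Finset V} {y : V}
    (hy : y ∉ C) (hPS : P ⊆ S) (hBC : Disjoint B C) :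
    ∫⋯∫⁻_B, (fun v => ∏ i ∈ P, κ i v) ∂μ = fun v =>
      (∫⋯∫⁻_(B ∩ D.moralComponent S C y),
        (fun v => ∏ i ∈ D.touching P (D.moralComponent S C y), κ i v) ∂μ) v *
      (∫⋯∫⁻_(B \ D.moralComponent S C y),
        (fun v => ∏ i ∈ P \ D.touching P (D.moralComponent S C y), κ i v) ∂μ) v := by
  set U := D.moralComponent S C y with hU
  have hsub : D.touching P U ⊆ P := by
    classical
    exact Finset.filter_subset _ _
  have hmem : ∀ v, v ∈ D.touching P U ↔ v ∈ P ∧ ∃ u ∈ U, u = v ∨ D.Adj u v := fun v => by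
    simp [DAG.touching]
  have hfac : (fun v => ∏ i ∈ P, κ i v) = fun v =>
      (∏ i ∈ D.touching P U, κ i v) * ∏ i ∈ P \ D.touching P U, κ i v := by
    funext v
    rw [mul_comm, Finset.prod_sdiff hsub]
  have hB : B = (B ∩ U) ∪ (B \ U) := by rw [Finset.union_comm, Finset.sdiff_union_inter]
  conv_lhs => rw [hB]
  rw [hfac]
  refine lmarginal_union_mul (Finset.disjoint_sdiff_inter B U).symm
    (hκ.measurable_prod _) (hκ.measurable_prod _) ?_ ?_
  -- The nodes of `{i} ∪ pa(i)` outside `C` are pairwise moral-adjacent, so a factor with one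
  -- argument in `U` has all its arguments in `U ∪ C`.
  · refine DependsOn.finset_prod fun i hi => (hκ.dependsOn i).mono fun j hj => ?_
    obtain ⟨hiP, u, hu, hui⟩ := (hmem i).1 hi
    simp only [Set.mem_compl_iff, Finset.mem_coe, Finset.mem_sdiff, not_and, not_not]
    intro hjB
    have hjC : j ∉ C := Finset.disjoint_left.1 hBC hjB
    have huC : u ∉ C := (DAG.mem_moralComponent.1 hu).notMem hy
    exact DAG.mem_moralComponent.2
      ((DAG.mem_moralComponent.1 hu).tail ⟨huC, hjC, i, hPS hiP, hui, hj⟩)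
  · refine DependsOn.finset_prod fun i hi => (hκ.dependsOn i).mono fun j hj => ?_
    rw [Finset.mem_sdiff, hmem] at hi
    simp only [Set.mem_compl_iff, Finset.mem_coe, Finset.mem_inter, not_and]
    exact fun _ hjU => hi.2 ⟨hi.1, j, hjU, hj⟩

/-- The Markov property: nodes that are not connected in the moral graph of the ancestors are
conditionally independent. -/
theorem IsCompatible.condIndepDensity {F : InterventionalFamily Ω} (hF : IsCompatible D μ F)
    {a b : V} {C : Finset V} (hb : b ∉ C)
    (h : ¬ D.MoralConn (D.ancestors (insert a (insert b C))) C a b) :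
    CondIndepDensity μ (F ∅) {a} {b} C := by
  obtain ⟨κ, hκ, hFκ⟩ := hF.exists_kernel
  set S := D.ancestors (insert a (insert b C)) with hS
  set U := D.moralComponent S C b with hU
  have hbU : b ∈ U := DAG.mem_moralComponent.2 .refl
  have haU : a ∉ U := fun h' => h (DAG.mem_moralComponent.1 h').symm
  have hm : ∀ A : Finset V, C ⊆ A → A ⊆ insert a (insert b C) →
      marginalDensity μ (F ∅) A =ᵐ[Measure.pi μ] fun v =>
        (∫⋯∫⁻_((S \ A) ∩ U), (fun v => ∏ i ∈ D.touching S U, κ i v) ∂μ) v *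
        (∫⋯∫⁻_((S \ A) \ U), (fun v => ∏ i ∈ S \ D.touching S U, κ i v) ∂μ) v := by
    intro A hCA hA
    refine (lmarginal_congr_ae Aᶜ (hFκ ∅)).trans (Filter.EventuallyEq.of_eq ?_)
    rw [hκ.lmarginal_compl_of_subset (S := S) (Finset.empty_subset _)
      (fun v hv => DAG.mem_ancestors_of_mem (hA hv)) DAG.ancestors_closed, Finset.sdiff_empty,
      hκ.lmarginal_separate hb subset_rfl (Finset.sdiff_disjoint.mono_right hCA)]
  filter_upwards [hm ({a} ∪ {b} ∪ C) (by grind) (by grind), hm C (by grind) (by grind),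
    hm ({a} ∪ C) (by grind) (by grind), hm ({b} ∪ C) (by grind) (by grind)] with v h1 h2 h3 h4
  rw [h1, h2, h3, h4]
  -- Since `a ∉ U` and `b ∈ U`, conditioning on `a` affects only the factor outside `U`, and
  -- conditioning on `b` only the one inside; the cross products agree.
  have e1 : (S \ ({a} ∪ {b} ∪ C)) ∩ U = (S \ ({b} ∪ C)) ∩ U := by grind
  have e2 : (S \ ({a} ∪ {b} ∪ C)) \ U = (S \ ({a} ∪ C)) \ U := by grind
  have e3 : (S \ ({a} ∪ C)) ∩ U = (S \ C) ∩ U := by grind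
  have e4 : (S \ ({b} ∪ C)) \ U = (S \ C) \ U := by grind
  rw [e1, e2, e3, e4]
  ring

/-- Soundness of adjustment: `Z` is an adjustment set if it contains no descendants of `X` and no
parent of `X` is connected to `y` in the moral graph of the ancestors, with `X` and `Z` removed. -/
theorem isAdjustmentSet_of_not_moralConn {X Z : Finset V} {y : V} (hyX : y ∉ X) (hyZ : y ∉ Z)
    (hXZ : Disjoint X Z) (hdesc : ∀ x ∈ X, ∀ z ∈ Z, ¬ D.IsAncestor x z)
    (hconn : ∀ x ∈ X, ∀ a, D.Adj a x →
      ¬ D.MoralConn (D.ancestors (X ∪ {y} ∪ Z)) (X ∪ Z) a y) :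
    IsAdjustmentSet.{u} D X {y} Z := by
  refine ⟨⟨by simpa using hyX, hXZ, by simpa using hyZ⟩, ?_⟩
  intro Ω _ μ _ F hF
  obtain ⟨κ, hκ, hFκ⟩ := hF.exists_kernel
  set S := D.ancestors (X ∪ {y} ∪ Z) with hS
  set C := X ∪ Z with hC
  set U := D.moralComponent S C y with hU
  have hyC : y ∉ C := by simp [hC, hyX, hyZ]
  have hyU : y ∈ U := DAG.mem_moralComponent.2 .refl
  have hXYZ : X ∪ {y} ∪ Z ⊆ S := fun v hv => DAG.mem_ancestors_of_mem hv
  have hXS : X ⊆ S := fun v hv => hXYZ (by grind)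
  have hm : ∀ A : Finset V, A ⊆ S → marginalDensity μ (F ∅) A =ᵐ[Measure.pi μ]
      ∫⋯∫⁻_(S \ A), (fun v => ∏ i ∈ S, κ i v) ∂μ := by
    intro A hA
    refine (lmarginal_congr_ae Aᶜ (hFκ ∅)).trans (Filter.EventuallyEq.of_eq ?_)
    rw [hκ.lmarginal_compl_of_subset (Finset.empty_subset _) hA DAG.ancestors_closed,
      Finset.sdiff_empty]
  -- Intervening on `X` leaves the law of `Z` unchanged: no node of `X` is an ancestor of `Z`, so
  -- both sides reduce to the kernels of the ancestors of `Z`.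
  have hZ : marginalDensity μ (F ∅) Z =ᵐ[Measure.pi μ]
      ∫⋯∫⁻_(S \ C), (fun v => ∏ i ∈ S \ X, κ i v) ∂μ := by
    refine (lmarginal_congr_ae Zᶜ (hFκ ∅)).trans (Filter.EventuallyEq.of_eq ?_)
    have hZA : Z ⊆ D.ancestors Z := fun v hv => DAG.mem_ancestors_of_mem hv
    have hAS : D.ancestors Z ⊆ S := DAG.ancestors_mono (by grind)
    have hAX : ∀ v ∈ D.ancestors Z, v ∉ X := fun v hv hvX => by
      obtain ⟨z, hz, hvz⟩ := DAG.mem_ancestors.1 hv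
      exact hdesc v hvX z hz hvz
    have e1 : (S \ X) \ ((S \ X) \ D.ancestors Z) = D.ancestors Z := by grind
    have e2 : (S \ C) \ ((S \ X) \ D.ancestors Z) = D.ancestors Z \ Z := by grind
    rw [hκ.lmarginal_compl_of_subset (Finset.empty_subset _) hZA DAG.ancestors_closed,
      Finset.sdiff_empty, lmarginal_lmarginal_of_subset (t := S \ C)
        (s := (S \ X) \ D.ancestors Z) (hκ.measurable_prod _) (by grind),
      hκ.lmarginal_prod (P := S \ X) Finset.sdiff_subset, e1, e2]
    intro v hv b hb hbv
    rw [e1] at hv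
    exact (Finset.mem_sdiff.1 hb).2 (DAG.ancestors_closed v hv b hbv)
  have hdo : doDensity μ F X {y} =ᵐ[Measure.pi μ]
      ∫⋯∫⁻_Z, ∫⋯∫⁻_(S \ (X ∪ {y} ∪ Z)), (fun v => ∏ i ∈ S \ X, κ i v) ∂μ ∂μ := by
    refine (lmarginal_congr_ae _ (hFκ X)).trans (Filter.EventuallyEq.of_eq ?_)
    rw [hκ.lmarginal_compl_of_subset hXS (by grind) DAG.ancestors_closed,
      ← lmarginal_union μ _ (hκ.measurable_prod _) (Finset.disjoint_sdiff.mono_left (by grind))]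
    have hdis : ∀ v ∈ Z, v ∉ X := fun v hv hvX => Finset.disjoint_left.1 hXZ hvX hv
    have hZS : Z ⊆ S := fun v hv => hXYZ (by grind)
    congr 1
    clear_value S C
    ext j
    simp only [Finset.mem_sdiff, Finset.mem_union, Finset.mem_singleton]
    have h1 : j ∈ Z → j ∈ S := fun h => hZS h
    have h2 : j ∈ Z → j ≠ y := fun h h' => hyZ (h' ▸ h)
    have h3 := hdis j
    tauto
  refine hdo.trans (lmarginal_congr_ae Z ?_).symm
  have hfin := marginalDensity_lt_top (μ := μ) (hF.measurable ∅)
    (by simp [hF.lintegral_eq_one]) C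
  have hpos := marginalDensity_pos (μ := μ) (hF.measurable ∅) hF.pos
    (by simp [hF.lintegral_eq_one]) C
  -- The back-door condition enters here: no kernel of a node of `X` involves a coordinate in `U`,
  -- so the intervention deletes only factors that cancel in `f(y | x, z)`.
  have htouch : D.touching (S \ X) U = D.touching S U := by
    ext v
    simp only [DAG.touching, Finset.mem_filter, Finset.mem_sdiff]
    refine ⟨fun h => ⟨h.1.1, h.2⟩, fun h => ⟨⟨h.1, fun hvX => ?_⟩, h.2⟩⟩
    obtain ⟨u, hu, rfl | huv⟩ := h.2
    · exact (DAG.mem_moralComponent.1 hu).notMem hyC (by grind)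
    · exact hconn v hvX u huv (DAG.mem_moralComponent.1 hu).symm
  filter_upwards [hm ({y} ∪ C) (by grind), hm C (by grind), hZ, hfin] with v h1 h2 h3 h4
  have h5 := hpos v
  rw [condDensity, h1, h2, h3]
  rw [h2] at h4 h5
  have e1 : S \ ({y} ∪ C) = S \ (X ∪ {y} ∪ Z) := by grind
  have e2 : (S \ (X ∪ {y} ∪ Z)) \ U = (S \ C) \ U := by grind
  rw [e1]
  have d1 : Disjoint (S \ C) C := Finset.sdiff_disjoint
  have d2 : Disjoint (S \ (X ∪ {y} ∪ Z)) C := Finset.sdiff_disjoint.mono_right (by grind)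
  rw [hκ.lmarginal_separate (y := y) hyC subset_rfl d1] at h4 h5 ⊢
  rw [hκ.lmarginal_separate (y := y) hyC subset_rfl d2,
    hκ.lmarginal_separate (y := y) hyC Finset.sdiff_subset d1,
    hκ.lmarginal_separate (y := y) hyC Finset.sdiff_subset d2]
  simp only [← hU, e2, htouch] at h4 h5 ⊢
  exact ENNReal.mul_div_mul_mul_cancel h5.ne' h4.ne

end Kernels

/-! ### Compatible families built from kernels -/

section KernelModel

variable {V : Type w} [Fintype V] [DecidableEq V] {Ω : V → Type u} [∀ v, MeasurableSpace (Ω v)]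
  {D : DAG V} {μ : ∀ v, Measure (Ω v)} [∀ v, SigmaFinite (μ v)] {κ : V → (∀ v, Ω v) → ℝ≥0∞}

/-- Positive kernels define a compatible family. -/
lemma IsKernelFamily.isCompatible (hκ : IsKernelFamily D μ κ) (hne : Nonempty (∀ v, Ω v))
    (hpos : ∀ i v, 0 < κ i v) (hlt : ∀ i v, κ i v < ∞) :
    IsCompatible D μ fun X v => ∏ i ∈ Xᶜ, κ i v := by
  have hint : ∫⁻ v, ∏ i ∈ (∅ : Finset V)ᶜ, κ i v ∂(Measure.pi μ) = 1 := by
    simpa using hκ.lintegral_prod hne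
  have hposf : ∀ v, 0 < ∏ i ∈ (∅ : Finset V)ᶜ, κ i v := fun v =>
    pos_iff_ne_zero.2 (Finset.prod_ne_zero_iff.2 fun i _ => (hpos i v).ne')
  refine ⟨fun X => hκ.measurable_prod _, hposf,
    fun v => ENNReal.prod_lt_top fun i _ => hlt i v, hint, fun X => ?_⟩
  have hfin : ∀ᵐ v ∂(Measure.pi μ), ∀ i, marginalDensity μ
      (fun v => ∏ i ∈ (∅ : Finset V)ᶜ, κ i v) (D.parents i) v < ∞ := by
    rw [ae_all_iff]
    exact fun i => marginalDensity_lt_top (hκ.measurable_prod _) (by rw [hint]; simp) _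
  filter_upwards [hfin] with v hv
  refine Finset.prod_congr rfl fun i _ => ?_
  have hp := marginalDensity_pos (μ := μ) (hκ.measurable_prod _) hposf (by rw [hint]; simp)
    (D.parents i) v
  suffices marginalDensity μ (fun v => ∏ i ∈ (∅ : Finset V)ᶜ, κ i v) ({i} ∪ D.parents i) v =
      κ i v * marginalDensity μ (fun v => ∏ i ∈ (∅ : Finset V)ᶜ, κ i v) (D.parents i) v by
    rw [condDensity, this, ENNReal.mul_div_cancel_right hp.ne' (hv i).ne]
  -- Both `S` and `insert i S` are ancestrally closed. Their products differ by the factor `κ i`,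
  -- which is constant in the coordinates `S \ pa(i)` that are integrated out.
  set S := D.ancestors (D.parents i) with hS
  have hiS : i ∉ S := fun h => by
    obtain ⟨a, ha, hia⟩ := DAG.mem_ancestors.1 h
    exact DAG.not_isAncestor_of_adj (by simpa [DAG.parents] using ha) hia
  have hpaS : D.parents i ⊆ S := fun v hv => DAG.mem_ancestors_of_mem hv
  have hclosed : ∀ v ∈ insert i S, ∀ u, D.Adj u v → u ∈ insert i S := by
    intro v hv u huv
    rcases Finset.mem_insert.1 hv with rfl | hv
    · exact Finset.mem_insert_of_mem (hpaS (by simpa [DAG.parents] using huv))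
    · exact Finset.mem_insert_of_mem (DAG.ancestors_closed v hv u huv)
  have e1 : insert i S \ ({i} ∪ D.parents i) = S \ D.parents i := by
    ext j
    simp only [Finset.mem_sdiff, Finset.mem_insert, Finset.mem_union, Finset.mem_singleton]
    have : j = i → j ∉ S := fun h => h ▸ hiS
    tauto
  rw [marginalDensity, marginalDensity,
    hκ.lmarginal_compl_of_subset (S := insert i S) (Finset.empty_subset _)
      (by rw [← Finset.insert_eq]; exact Finset.insert_subset_insert _ hpaS) hclosed,
    hκ.lmarginal_compl_of_subset (S := S) (Finset.empty_subset _) hpaS DAG.ancestors_closed,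
    Finset.sdiff_empty, Finset.sdiff_empty, e1]
  simp only [Finset.prod_insert hiS]
  rw [lmarginal_mul_left (hκ.measurable_prod S)]
  refine (hκ.dependsOn i).mono fun j hj => ?_
  simp only [Set.mem_compl_iff, Finset.mem_coe, Finset.mem_sdiff, not_and, not_not]
  intro hjS
  rcases hj with rfl | hj
  · exact absurd hjS hiS
  · simpa [DAG.parents] using hj

end KernelModel

/-! ### Back-door walks indexed by position -/

namespace DAG

variable {V : Type w}

/-- A walk `p 0, …, p N` from `x`, whose edge between `p i` and `p (i + 1)` points to the latter
if `e i` holds. It starts against an edge into `x`, its later nodes differ from `x`, and its inner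
nodes are colliders exactly if they lie in `Z`. -/
structure IsBackdoorWalk (D : DAG V) (x : V) (Z : Finset V) (N : ℕ) (p : ℕ → V) (e : ℕ → Bool) :
    Prop where
  pos : 0 < N
  start : p 0 = x
  first : e 0 = false
  forward : ∀ i < N, e i = true → D.Adj (p i) (p (i + 1))
  backward : ∀ i < N, e i = false → D.Adj (p (i + 1)) (p i)
  ne_start : ∀ i < N, p (i + 1) ≠ x
  mem_iff : ∀ i, i + 1 < N → (p (i + 1) ∈ Z ↔ e i = true ∧ e (i + 1) = false)

variable {D : DAG V} {x y : V} {Z : Finset V}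

lemma IsBackdoorWalk.extend {N : ℕ} {p : ℕ → V} {e : ℕ → Bool} {v : V} {d : Bool}
    (h : D.IsBackdoorWalk x Z (N + 1) p e) (hv : v ≠ x)
    (hf : d = true → D.Adj (p (N + 1)) v) (hb : d = false → D.Adj v (p (N + 1)))
    (hZ : p (N + 1) ∈ Z ↔ e N = true ∧ d = false) :
    D.IsBackdoorWalk x Z (N + 2) (fun i => if i ≤ N + 1 then p i else v)
      (fun i => if i ≤ N then e i else d) := by
  have split : ∀ i < N + 2, i < N + 1 ∨ i = N + 1 := fun i hi => by omega
  refine ⟨by omega, by simp [h.start], by simp [h.first], fun i hi => ?_, fun i hi => ?_,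
    fun i hi => ?_, fun i hi => ?_⟩
  · rcases split i hi with hi | rfl
    · simpa [show i ≤ N + 1 by omega, show i ≤ N by omega] using h.forward i hi
    · simpa using hf
  · rcases split i hi with hi | rfl
    · simpa [show i ≤ N + 1 by omega, show i ≤ N by omega] using h.backward i hi
    · simpa using hb
  · rcases split i hi with hi | rfl
    · simpa [show i ≤ N by omega] using h.ne_start i hi
    · simpa using hv
  · rcases split (i + 1) hi with hi | hi
    · simpa [show i ≤ N by omega, show i + 1 ≤ N by omega] using h.mem_iff i hi
    · obtain rfl : i = N := by omega
      simpa using hZ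

/-- Loops are kept: the parity model gives each position its own bit, so a node may be visited
repeatedly. -/
lemma Reach.exists_isBackdoorWalk {v : V} {d : Bool} (h : D.Reach x y Z False v d) :
    ∃ (N : ℕ) (p : ℕ → V) (e : ℕ → Bool), D.IsBackdoorWalk x Z (N + 1) p e ∧ p (N + 1) = v ∧
      e N = d := by
  induction h with
  | @start v h =>
    refine ⟨0, fun i => if i = 0 then x else v, fun _ => false,
      ⟨by omega, by simp, rfl, by simp, fun i hi => ?_, fun i hi => ?_, ?_⟩, by simp, rfl⟩
    · obtain rfl : i = 0 := by omega
      simpa using h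
    · simpa using adj_ne h
    · intro i hi
      omega
  | startOut h => exact h.elim
  | @down u v d _ hu huy huv hv ih =>
    obtain ⟨N, p, e, hw, rfl, rfl⟩ := ih
    exact ⟨N + 1, _, _, hw.extend (v := v) (d := true) hv (fun _ => huv) (by simp)
      (by simp [hu]), by simp, by simp⟩
  | @up u v _ hu huy huv hv ih =>
    obtain ⟨N, p, e, hw, rfl, he⟩ := ih
    exact ⟨N + 1, _, _, hw.extend (v := v) (d := false) hv (by simp) (fun _ => huv)
      (by simp [hu, he]), by simp, by simp⟩
  | @bounce u v _ hu huy huv hv ih =>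
    obtain ⟨N, p, e, hw, rfl, he⟩ := ih
    exact ⟨N + 1, _, _, hw.extend (v := v) (d := false) hv (by simp) (fun _ => huv)
      (by simp [hu, he]), by simp, by simp⟩

end DAG

/-- The states of the nodes of a parity model along a walk with `N` edges: each node carries a bit
for each position on the walk, of which those for the positions of the node matter. -/
def BitState (N : ℕ) : Type u := ULift.{u} (Fin (N + 1) → ZMod 2)

namespace BitState

variable {N : ℕ}

instance : MeasurableSpace (BitState.{u} N) := ⊤

instance : DiscreteMeasurableSpace (BitState.{u} N) := ⟨fun _ => trivial⟩

instance : Fintype (BitState.{u} N) := inferInstanceAs (Fintype (ULift (Fin (N + 1) → ZMod 2)))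

/-- The bits of a state. -/
def get (s : BitState.{u} N) : Fin (N + 1) → ZMod 2 := ULift.down s

/-- The state with given bits. -/
def of (b : Fin (N + 1) → ZMod 2) : BitState.{u} N := ULift.up b

@[simp] lemma get_of (b : Fin (N + 1) → ZMod 2) : (of.{u} b).get = b := rfl

end BitState

/-! ### The parity model: propagation of bits along a walk -/

section ParityModel

variable {V : Type w} {N : ℕ}

/-- The bit at position `i` of the walk `p`. -/
def walkBit (p : ℕ → V) (ω : V → BitState.{u} N) (i : ℕ) : ZMod 2 :=
  (ω (p i)).get (Fin.ofNat (N + 1) i)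

/-- The sum of the bits of the parents of position `i` on the walk. -/
def parentSum (p : ℕ → V) (e : ℕ → Bool) (ω : V → BitState.{u} N) (i : ℕ) : ZMod 2 :=
  (if 0 < i ∧ e (i - 1) = true then walkBit p ω (i - 1) else 0) +
    (if i < N ∧ e i = false then walkBit p ω (i + 1) else 0)

variable [DecidableEq V]

/-- The noise in bit `i` of node `v`. -/
def bitNoise (p : ℕ → V) (e : ℕ → Bool) (v : V) (i : Fin (N + 1)) (ω : V → BitState.{u} N) :
    ZMod 2 :=
  (ω v).get i + if p i = v then parentSum p e ω i else 0

/-- Bit `i` of node `v` is a copy of, or the sum of, other bits, up to noise. -/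
def IsInner (p : ℕ → V) (e : ℕ → Bool) (v : V) (i : Fin (N + 1)) : Prop :=
  p i = v ∧ ((0 < (i : ℕ) ∧ e (i - 1) = true) ∨ ((i : ℕ) < N ∧ e i = false))

open Classical in
/-- The probability of noise in bit `i` of node `v`. -/
noncomputable def noiseProb (p : ℕ → V) (e : ℕ → Bool) (η δ : ℝ) (v : V) (i : Fin (N + 1)) : ℝ :=
  if IsInner p e v i then δ else η

/-- The weight of the noise `n` if its probability is `q`. -/
def noiseWeight (q : ℝ) (n : ZMod 2) : ℝ := if n = 0 then 1 - q else q

/-- The conditional density of node `v` given its parents. -/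
noncomputable def parityKernel (p : ℕ → V) (e : ℕ → Bool) (η δ : ℝ) (v : V)
    (ω : V → BitState.{u} N) : ℝ≥0∞ :=
  ∏ i : Fin (N + 1), ENNReal.ofReal (noiseWeight (noiseProb p e η δ v i) (bitNoise p e v i ω))

/-- The sum of the starting bit and of the bits at the colliders up to position `i`. -/
def walkSum (p : ℕ → V) (Z : Finset V) (ω : V → BitState.{u} N) : ℕ → ZMod 2
  | 0 => walkBit p ω 0
  | i + 1 => walkSum p Z ω i + if p (i + 1) ∈ Z then walkBit p ω (i + 1) else 0

variable {D : DAG V} {x y : V} {Z : Finset V} {p : ℕ → V} {e : ℕ → Bool}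

lemma walkBit_congr {ω ω' : V → BitState.{u} N} {i : ℕ} (h : ω (p i) = ω' (p i)) :
    walkBit p ω i = walkBit p ω' i := by
  simp only [walkBit, h]

lemma val_ofNat_of_le {i : ℕ} (hi : i ≤ N) : ((Fin.ofNat (N + 1) i : Fin (N + 1)) : ℕ) = i := by
  simp [Fin.ofNat, Nat.mod_eq_of_lt (by omega : i < N + 1)]

lemma bitNoise_walk (ω : V → BitState.{u} N) {i : ℕ} (hi : i ≤ N) :
    bitNoise p e (p i) (Fin.ofNat (N + 1) i) ω = walkBit p ω i + parentSum p e ω i := by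
  rw [bitNoise, val_ofNat_of_le hi, if_pos rfl]
  rfl

/-- Without noise in the inner bits, the bit at the end of the walk is the sum of the starting bit
and of the bits at the colliders. -/
lemma DAG.IsBackdoorWalk.walkBit_last (hw : D.IsBackdoorWalk x Z N p e) (hN : p N ∉ Z)
    {ω : V → BitState.{u} N} (h : ∀ v i, IsInner p e v i → bitNoise p e v i ω = 0) :
    walkBit p ω N = walkSum p Z ω N := by
  have hn : ∀ i ≤ N, ((0 < i ∧ e (i - 1) = true) ∨ (i < N ∧ e i = false)) →
      walkBit p ω i = parentSum p e ω i := by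
    intro i hi hin
    have hv := val_ofNat_of_le hi
    have := h (p i) (Fin.ofNat (N + 1) i) ⟨by rw [hv], by rwa [hv]⟩
    rw [bitNoise_walk ω hi] at this
    exact CharTwo.add_eq_zero.1 this
  -- Invariant: the bit at the tail of each edge is the sum collected so far. Non-colliders hand it
  -- on; a collider bit is the sum of the two adjacent tail bits, so passing it adds that bit.
  have tail : ∀ i < N, (if e i = true then walkBit p ω i else walkBit p ω (i + 1)) =
      walkSum p Z ω i := by
    intro i hi
    induction i with
    | zero =>
      have := hn 0 (by omega) (.inr ⟨hi, hw.first⟩)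
      simpa [walkSum, parentSum, hw.first, hi] using this.symm
    | succ i ih =>
      have ih := ih (by omega)
      have hm := hw.mem_iff i hi
      have h1 := hn (i + 1) (by omega)
      rw [walkSum, ← ih]
      cases h2 : e i <;> cases h3 : e (i + 1) <;>
        simp [h2, h3, parentSum, hi] at h1 hm ⊢
      · simp [hm, h1]
      · simp [hm]
      · simp [hm, h1, ← add_assoc, CharTwo.add_self_eq_zero]
      · simp [hm, h1]
  obtain ⟨n, rfl⟩ : ∃ n, N = n + 1 := ⟨N - 1, by have := hw.pos; omega⟩
  rw [walkSum, if_neg hN, add_zero, ← tail n (by omega)]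
  cases h4 : e n
  · simp
  · simpa [parentSum, h4] using hn (n + 1) le_rfl (.inl (by simpa using h4))

/-- The bits at `x` and at the nodes of `Z` extend to an assignment without noise in the inner
bits. -/
lemma DAG.IsBackdoorWalk.exists_noiseless (hw : D.IsBackdoorWalk x Z N p e) (hxZ : x ∉ Z)
    (hN : p N ∉ Z) (ω : V → BitState.{u} N) :
    ∃ ω' : V → BitState.{u} N, (∀ v, v = x ∨ v ∈ Z → ω' v = ω v) ∧
      ∀ v i, IsInner p e v i → bitNoise p e v i ω' = 0 := by
  classical
  -- The running sum is the value that the absence of noise forces on the tails of the edges.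
  let ω' : V → BitState.{u} N := fun v => if v = x ∨ v ∈ Z then ω v else
    BitState.of fun i => walkSum p Z ω i
  have hω' : ∀ v, v = x ∨ v ∈ Z → ω' v = ω v := fun v hv => if_pos hv
  have hbZ : ∀ i, p i ∈ Z → walkBit p ω' i = walkBit p ω i := fun i hi =>
    walkBit_congr (hω' _ (.inr hi))
  have hb : ∀ i ≤ N, p i ∉ Z → walkBit p ω' i = walkSum p Z ω i := by
    intro i hi hiZ
    rcases Nat.eq_zero_or_pos i with rfl | hi0
    · rw [walkBit_congr (hω' _ (.inl hw.start))]
      rfl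
    · have hix : p i ≠ x := by
        have := hw.ne_start (i - 1) (by omega)
        rwa [Nat.sub_add_cancel hi0] at this
      have : ω' (p i) = BitState.of fun i => walkSum p Z ω i := if_neg (by simp [hiZ, hix])
      rw [walkBit, this, BitState.get_of, val_ofNat_of_le hi]
  refine ⟨ω', hω', fun v i hin => ?_⟩
  obtain ⟨hv, hin⟩ := hin
  obtain ⟨j, hj, rfl⟩ : ∃ j, ∃ _ : j ≤ N, i = Fin.ofNat (N + 1) j :=
    ⟨i, by omega, by ext; rw [val_ofNat_of_le (by omega)]⟩
  rw [val_ofNat_of_le hj] at hv hin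
  rw [← hv, bitNoise_walk ω' hj, CharTwo.add_eq_zero, parentSum]
  have left : ∀ i < N, e i = true → p i ∉ Z := by
    intro i hi he hiZ
    rcases Nat.eq_zero_or_pos i with rfl | hi0
    · simp [hw.first] at he
    · obtain ⟨k, rfl⟩ : ∃ k, i = k + 1 := ⟨i - 1, by omega⟩
      simp [((hw.mem_iff k hi).1 hiZ).2] at he
  have right : ∀ i < N, e i = false → p (i + 1) ∉ Z := by
    intro i hi he hiZ
    rcases Nat.lt_or_ge (i + 1) N with hi' | hi'
    · simp [((hw.mem_iff i hi').1 hiZ).1] at he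
    · obtain rfl : i + 1 = N := by omega
      exact hN hiZ
  by_cases h1 : 0 < j ∧ e (j - 1) = true
  · obtain ⟨k, rfl⟩ : ∃ k, j = k + 1 := ⟨j - 1, by omega⟩
    have hek : e k = true := by simpa using h1
    rw [if_pos h1, Nat.add_sub_cancel, hb k (by omega) (left k (by omega) hek)]
    by_cases h2 : k + 1 < N ∧ e (k + 1) = false
    · have hZ : p (k + 1) ∈ Z := (hw.mem_iff k h2.1).2 ⟨hek, h2.2⟩
      have hZ' := right (k + 1) h2.1 h2.2
      rw [if_pos h2, hb (k + 2) (by omega) hZ', hbZ _ hZ, walkSum, walkSum, if_pos hZ, if_neg hZ',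
        add_zero, ← add_assoc, CharTwo.add_self_eq_zero, zero_add]
    · have hZ : p (k + 1) ∉ Z := by
        intro hZ
        rcases Nat.lt_or_ge (k + 1) N with h3 | h3
        · exact h2 ⟨h3, ((hw.mem_iff k h3).1 hZ).2⟩
        · obtain rfl : k + 1 = N := by omega
          exact hN hZ
      rw [if_neg h2, add_zero, hb _ hj hZ, walkSum, if_neg hZ, add_zero]
  · have h2 := hin.resolve_left h1
    have hZ : p j ∉ Z := by
      intro hZ
      rcases Nat.eq_zero_or_pos j with rfl | hj0
      · exact hxZ (hw.start ▸ hZ)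
      · obtain ⟨k, rfl⟩ : ∃ k, j = k + 1 := ⟨j - 1, by omega⟩
        exact h1 ⟨hj0, ((hw.mem_iff k h2.1).1 hZ).1⟩
    have hZ' := right j h2.1 h2.2
    rw [if_neg h1, if_pos h2, zero_add, hb j hj hZ, hb (j + 1) (by omega) hZ', walkSum, if_neg hZ',
      add_zero]

end ParityModel

/-! ### The parity model: densities and the failure of adjustment -/

section ParityModelMeasure

variable {V : Type w} [DecidableEq V] {N : ℕ} {D : DAG V} {x y : V} {Z : Finset V} {p : ℕ → V}
  {e : ℕ → Bool} {η δ : ℝ}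

lemma noiseWeight_nonneg {q : ℝ} (h0 : 0 ≤ q) (h1 : q ≤ 1) (n : ZMod 2) : 0 ≤ noiseWeight q n := by
  unfold noiseWeight
  split_ifs <;> linarith

lemma noiseWeight_le_one {q : ℝ} (h0 : 0 ≤ q) (h1 : q ≤ 1) (n : ZMod 2) : noiseWeight q n ≤ 1 := by
  unfold noiseWeight
  split_ifs <;> linarith

lemma noiseWeight_pos {q : ℝ} (h0 : 0 < q) (h1 : q < 1) (n : ZMod 2) : 0 < noiseWeight q n := by
  unfold noiseWeight
  split_ifs <;> linarith

lemma sum_noiseWeight {q : ℝ} (h0 : 0 ≤ q) (h1 : q ≤ 1) (c : ZMod 2) :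
    ∑ b : ZMod 2, ENNReal.ofReal (noiseWeight q (b + c)) = 1 := by
  have hshift : ∑ b : ZMod 2, ENNReal.ofReal (noiseWeight q (b + c)) =
      ∑ n : ZMod 2, ENNReal.ofReal (noiseWeight q n) :=
    Equiv.sum_comp (Equiv.addRight c) fun n => ENNReal.ofReal (noiseWeight q n)
  rw [hshift, show (Finset.univ : Finset (ZMod 2)) = {0, 1} from rfl, Finset.sum_pair (by decide),
    ← ENNReal.ofReal_add (noiseWeight_nonneg h0 h1 _) (noiseWeight_nonneg h0 h1 _)]
  simp [noiseWeight]

lemma noiseProb_mem (P : ℝ → Prop) (hη : P η) (hδ : P δ) (v : V) (i : Fin (N + 1)) :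
    P (noiseProb p e η δ v i) := by
  unfold noiseProb
  split_ifs <;> assumption

/-- Apart from the starting bit, the sum collects bits at nodes of `Z` only. -/
lemma walkSum_add_congr {ω ω' : V → BitState.{u} N} (h : ∀ v ∈ Z, ω v = ω' v) (n : ℕ) :
    walkSum p Z ω n + walkBit p ω' 0 = walkSum p Z ω' n + walkBit p ω 0 := by
  induction n with
  | zero => exact add_comm _ _
  | succ n ih =>
    have : (if p (n + 1) ∈ Z then walkBit p ω (n + 1) else 0) =
        if p (n + 1) ∈ Z then walkBit p ω' (n + 1) else 0 :=
      if_ctx_congr Iff.rfl (fun h' => walkBit_congr (h _ h')) fun _ => rfl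
    rw [walkSum, walkSum, this, add_right_comm, ih, add_right_comm]

lemma DAG.IsBackdoorWalk.parentSum_congr (hw : D.IsBackdoorWalk x Z N p e) {i : ℕ} (hi : i ≤ N)
    {ω ω' : V → BitState.{u} N} (h : ∀ v, D.Adj v (p i) → ω v = ω' v) :
    parentSum p e ω i = parentSum p e ω' i := by
  unfold parentSum
  congr 1
  · refine if_ctx_congr Iff.rfl (fun h' => walkBit_congr (h _ ?_)) fun _ => rfl
    have := hw.forward (i - 1) (by omega) h'.2
    rwa [Nat.sub_add_cancel h'.1] at this
  · exact if_ctx_congr Iff.rfl (fun h' => walkBit_congr (h _ (hw.backward i h'.1 h'.2)))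
      fun _ => rfl

/-- Given the parents, the noise of a node is a shift of its bits, so the sum over its states
factors into one normalized sum for each bit. -/
lemma DAG.IsBackdoorWalk.isKernelFamily [Fintype V] (hw : D.IsBackdoorWalk x Z N p e)
    (hη : 0 ≤ η ∧ η ≤ 1) (hδ : 0 ≤ δ ∧ δ ≤ 1) :
    IsKernelFamily D (fun _ : V => (Measure.count : Measure (BitState.{u} N)))
      (parityKernel p e η δ) := by
  refine ⟨fun i => measurable_of_countable _, fun v ω ω' h => ?_, fun v ω => ?_⟩
  · refine Finset.prod_congr rfl fun i _ => ?_
    have : bitNoise p e v i ω = bitNoise p e v i ω' := by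
      unfold bitNoise
      rw [h v (.inl rfl)]
      congr 1
      refine if_ctx_congr Iff.rfl (fun h' => hw.parentSum_congr (by omega) fun j hj => ?_)
        fun _ => rfl
      exact h j (.inr (h' ▸ hj))
    rw [this]
  · rw [lmarginal_singleton]
    simp only
    rw [lintegral_count, tsum_fintype]
    have hc : ∀ (s : BitState.{u} N) (i : Fin (N + 1)),
        bitNoise p e v i (Function.update ω v s) =
          s.get i + if p i = v then parentSum p e ω i else 0 := by
      intro s i
      unfold bitNoise
      rw [Function.update_self]
      congr 1
      refine if_ctx_congr Iff.rfl (fun h' => hw.parentSum_congr (by omega) fun j hj => ?_)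
        fun _ => rfl
      exact Function.update_of_ne (DAG.adj_ne (h' ▸ hj)) _ _
    simp only [parityKernel, hc]
    let g : Fin (N + 1) → ZMod 2 → ℝ≥0∞ := fun i b => ENNReal.ofReal
      (noiseWeight (noiseProb p e η δ v i) (b + if p i = v then parentSum p e ω i else 0))
    have hsum : ∑ s : BitState.{u} N, ∏ i, g i (s.get i) =
        ∑ b : Fin (N + 1) → ZMod 2, ∏ i, g i (b i) :=
      Equiv.ulift.sum_comp fun b : Fin (N + 1) → ZMod 2 => ∏ i, g i (b i)
    change ∑ s : BitState.{u} N, ∏ i, g i (s.get i) = 1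
    rw [hsum, ← Fintype.piFinset_univ, ← Finset.prod_univ_sum]
    refine Finset.prod_eq_one fun i _ => ?_
    have hq := noiseProb_mem (p := p) (e := e) (fun q => 0 ≤ q ∧ q ≤ 1) hη hδ v i
    exact sum_noiseWeight hq.1 hq.2 _

lemma prod_parityKernel (A : Finset V) (ω : V → BitState.{u} N) :
    ∏ v ∈ A, parityKernel p e η δ v ω = ∏ j ∈ A ×ˢ (Finset.univ : Finset (Fin (N + 1))),
      ENNReal.ofReal (noiseWeight (noiseProb p e η δ j.1 j.2) (bitNoise p e j.1 j.2 ω)) := by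
  rw [Finset.prod_product]
  rfl

lemma prod_parityKernel_le (hη : 0 ≤ η ∧ η ≤ 1) (hδ : 0 ≤ δ ∧ δ ≤ 1) {A : Finset V}
    {ω : V → BitState.{u} N} {v : V} {i : Fin (N + 1)} (hv : v ∈ A) (hi : IsInner p e v i)
    (hn : bitNoise p e v i ω ≠ 0) :
    ∏ v ∈ A, parityKernel p e η δ v ω ≤ ENNReal.ofReal δ := by
  rw [prod_parityKernel, ← Finset.mul_prod_erase _ _
    (Finset.mem_product.2 ⟨hv, Finset.mem_univ i⟩ : (v, i) ∈ A ×ˢ Finset.univ)]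
  have h1 : noiseWeight (noiseProb p e η δ v i) (bitNoise p e v i ω) = δ := by
    simp [noiseWeight, noiseProb, hi, hn]
  simp only [h1]
  refine mul_le_of_le_one_right' (Finset.prod_le_one' fun j _ => ?_)
  have hq := noiseProb_mem (p := p) (e := e) (fun q => 0 ≤ q ∧ q ≤ 1) hη hδ j.1 j.2
  exact ENNReal.ofReal_le_one.2 (noiseWeight_le_one hq.1 hq.2 _)

/-- The exponent counts the bits of all nodes, so that one bound serves every `A`; as `c ≤ 1`, this
only weakens it. -/
lemma le_prod_parityKernel [Fintype V] {A : Finset V} {ω : V → BitState.{u} N} {c : ℝ} (hc0 : 0 ≤ c)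
    (hc1 : c ≤ 1) (h : ∀ v ∈ A, ∀ i,
      c ≤ noiseWeight (noiseProb p e η δ v i) (bitNoise p e v i ω)) :
    ENNReal.ofReal (c ^ Fintype.card (V × Fin (N + 1))) ≤ ∏ v ∈ A, parityKernel p e η δ v ω := by
  rw [prod_parityKernel]
  calc ENNReal.ofReal (c ^ Fintype.card (V × Fin (N + 1)))
      ≤ ENNReal.ofReal c ^ (A ×ˢ (Finset.univ : Finset (Fin (N + 1)))).card := by
        rw [← ENNReal.ofReal_pow hc0]
        exact ENNReal.ofReal_le_ofReal (pow_le_pow_of_le_one hc0 hc1 (Finset.card_le_univ _))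
    _ ≤ _ := by
        rw [← Finset.prod_const]
        refine Finset.prod_le_prod' fun j hj => ENNReal.ofReal_le_ofReal ?_
        exact h _ (Finset.mem_product.1 hj).1 _

/-- Under counting measure an integral dominates each single value of the integrand. -/
lemma le_lmarginal_count [Fintype V] (f : (V → BitState.{u} N) → ℝ≥0∞) {s : Finset V}
    {ω ω' : V → BitState.{u} N} (h : ∀ v ∉ s, ω' v = ω v) :
    f ω' ≤ (∫⋯∫⁻_s, f ∂fun _ => Measure.count) ω := by
  have hz : Function.updateFinset ω s (fun i => ω' i) = ω' := by
    funext v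
    by_cases hv : v ∈ s
    · simp [Function.updateFinset, hv]
    · simp [Function.updateFinset, hv, h v hv]
  calc f ω' = ∫⁻ z in {fun i : s => ω' i}, f (Function.updateFinset ω s z)
        ∂(Measure.pi fun _ : s => Measure.count) := by
        rw [lintegral_singleton, hz, Measure.pi_singleton]
        simp
    _ ≤ _ := setLIntegral_le_lintegral _ _

end ParityModelMeasure

/-- A walk that starts against an edge into `x` and is open given `Z` refutes adjustment for `Z`. -/
theorem DAG.IsBackdoorWalk.not_isAdjustmentSet {V : Type w} [Fintype V] [DecidableEq V] {D : DAG V}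
    {x y : V} {Z : Finset V} {N : ℕ} {p : ℕ → V} {e : ℕ → Bool}
    (hw : D.IsBackdoorWalk x Z N p e) (hN : p N = y) : ¬ IsAdjustmentSet.{u} D {x} {y} Z := by
  rintro ⟨⟨hxy, hxZ, hyZ⟩, hadj⟩
  replace hxy : x ≠ y := by simpa using hxy
  replace hxZ : x ∉ Z := by simpa using hxZ
  replace hyZ : y ∉ Z := by simpa using hyZ
  have hNZ : p N ∉ Z := hN ▸ hyZ
  let μ : V → Measure (BitState.{u} N) := fun _ => Measure.count
  set M := Fintype.card (V × Fin (N + 1)) with hM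
  -- By Bernoulli's inequality, `η` can be so small that all `M` bits are free of noise with
  -- probability at least `3/4`.
  obtain ⟨η, hη0, hη4, hηM⟩ : ∃ η : ℝ, 0 < η ∧ η ≤ 1 / 4 ∧ 3 / 4 ≤ (1 - η) ^ M := by
    refine ⟨1 / (4 * (M + 1)), by positivity, ?_, ?_⟩
    · exact one_div_le_one_div_of_le (by norm_num) (by linarith [Nat.cast_nonneg (α := ℝ) M])
    · have hle : (1 : ℝ) / (4 * (M + 1)) ≤ 1 / 4 :=
        one_div_le_one_div_of_le (by norm_num) (by linarith [Nat.cast_nonneg (α := ℝ) M])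
      have := one_add_mul_le_pow (a := -(1 / (4 * (M + 1)) : ℝ)) (by linarith) M
      have h2 : (M : ℝ) * (1 / (4 * (M + 1))) ≤ 1 / 4 := by
        rw [mul_one_div, div_le_div_iff₀ (by positivity) (by norm_num)]
        linarith
      rw [← sub_eq_add_neg] at this
      linarith
  set B : Finset V := ({y} ∪ ({x} ∪ Z))ᶜ with hB
  obtain ⟨k, hk0, hk⟩ : ∃ k : ℝ, 0 ≤ k ∧
      (Measure.pi fun i : B => μ i) Set.univ = ENNReal.ofReal k :=
    ⟨_, ENNReal.toReal_nonneg, (ENNReal.ofReal_toReal (measure_ne_top _ _)).symm⟩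
  -- If noise in an inner bit is forced, `f(x, y, z) ≤ δ k`, where `k` counts the states integrated
  -- out, while `f(x, z) ≥ η ^ M`. The choice of `δ` makes the quotient at most `1/4`.
  obtain ⟨δ, hδ0, hδη, hδk⟩ : ∃ δ : ℝ, 0 < δ ∧ δ ≤ η ∧ δ * k ≤ η ^ M / 4 := by
    refine ⟨min η (η ^ M / 4 / (k + 1)), by positivity, min_le_left _ _, ?_⟩
    calc min η (η ^ M / 4 / (k + 1)) * k ≤ (η ^ M / 4 / (k + 1)) * (k + 1) := by
          gcongr
          · exact min_le_right _ _
          · linarith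
      _ = η ^ M / 4 := by field_simp
  have hη1 : 0 ≤ η ∧ η ≤ 1 := ⟨hη0.le, by linarith⟩
  have hδ1 : 0 ≤ δ ∧ δ ≤ 1 := ⟨hδ0.le, by linarith⟩
  set κ : V → (V → BitState.{u} N) → ℝ≥0∞ := parityKernel p e η δ with hκdef
  have hκ : IsKernelFamily D μ κ := hw.isKernelFamily hη1 hδ1
  have hprob : ∀ v i, δ ≤ noiseProb (N := N) p e η δ v i ∧ noiseProb (N := N) p e η δ v i ≤ η :=
    noiseProb_mem (fun q => δ ≤ q ∧ q ≤ η) ⟨hδη, le_rfl⟩ ⟨le_rfl, hδη⟩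
  have hne : Nonempty (V → BitState.{u} N) := ⟨fun _ => BitState.of 0⟩
  have hcomp : IsCompatible D μ fun X ω => ∏ v ∈ Xᶜ, κ v ω := by
    refine hκ.isCompatible hne (fun v ω => ?_) (fun v ω => ?_)
    · refine pos_iff_ne_zero.2 (Finset.prod_ne_zero_iff.2 fun i _ => ?_)
      have := hprob v i
      exact (ENNReal.ofReal_pos.2
        (noiseWeight_pos (by linarith) (by linarith) _)).ne'
    · exact ENNReal.prod_lt_top fun i _ => ENNReal.ofReal_lt_top
  set f : (V → BitState.{u} N) → ℝ≥0∞ := fun ω => ∏ v ∈ (∅ : Finset V)ᶜ, κ v ω with hf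
  have hfm : Measurable f := hκ.measurable_prod _
  have hf1 : ∫⁻ ω, f ω ∂(Measure.pi μ) = 1 := hcomp.lintegral_eq_one
  -- the assignment with a single bit set, at `x`
  let ω₁ : V → BitState.{u} N := fun v => BitState.of fun i => if v = x ∧ i = 0 then 1 else 0
  have hbit₁ : ∀ i, p i ≠ x → walkBit p ω₁ i = 0 := fun i hi => by
    simp [walkBit, ω₁, hi]
  have hstart₁ : walkBit p ω₁ 0 = 1 := by
    simp [walkBit, ω₁, hw.start, Fin.ofNat]
  have hweight : ∀ (ω : V → BitState.{u} N) (v : V) (i : Fin (N + 1)), bitNoise p e v i ω = 0 →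
      1 - η ≤ noiseWeight (noiseProb p e η δ v i) (bitNoise p e v i ω) := by
    intro ω v i h
    rw [h, noiseWeight, if_pos rfl]
    linarith [(hprob v i).2]
  have heq := hadj (fun _ => BitState.{u} N) μ _ hcomp
  have heq₁ : doDensity μ (fun X ω => ∏ v ∈ Xᶜ, κ v ω) {x} {y} ω₁ =
      adjustmentDensity μ f {x} {y} Z ω₁ := by
    by_contra hne
    have h0 : Measure.pi μ {ω₁} = 0 :=
      measure_mono_null (Set.singleton_subset_iff.2 hne) (ae_iff.1 heq)
    simp [μ, Measure.pi_singleton] at h0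
  -- No other bit reads the bit set at `x`, as the walk starts against an edge into `x`. Hence `ω₁`
  -- has no noise outside `x`, and under the intervention `y` is most likely in state zero.
  have hdo : ENNReal.ofReal (3 / 4) ≤ doDensity μ (fun X ω => ∏ v ∈ Xᶜ, κ v ω) {x} {y} ω₁ := by
    refine le_trans ?_ (le_lmarginal_count _ fun v _ => rfl)
    refine (ENNReal.ofReal_le_ofReal hηM).trans
      (le_prod_parityKernel (by linarith) (by linarith) fun v hv i => hweight _ _ _ ?_)
    have hvx : v ≠ x := by simpa using hv
    have hsum : p i = v → parentSum p e ω₁ i = 0 := by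
      intro hiv
      unfold parentSum
      have h1 : 0 < (i : ℕ) ∧ e (i - 1) = true → walkBit p ω₁ (i - 1) = 0 := by
        rintro ⟨hi0, hei⟩
        refine hbit₁ _ ?_
        have h0 : (i : ℕ) - 1 ≠ 0 := fun h0 => by simp [h0, hw.first] at hei
        have := hw.ne_start (i - 1 - 1) (by omega)
        rwa [Nat.sub_add_cancel (by omega)] at this
      have h2 : (i : ℕ) < N ∧ e i = false → walkBit p ω₁ (i + 1) = 0 := fun h =>
        hbit₁ _ (hw.ne_start i h.1)
      rw [ite_eq_right_iff.2 h1, ite_eq_right_iff.2 h2, add_zero]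
    rw [bitNoise, ite_eq_right_iff.2 hsum]
    simp [ω₁, hvx]
  have hzero : ENNReal.ofReal (3 / 4) ≤ f fun _ => BitState.of 0 := by
    refine (ENNReal.ofReal_le_ofReal hηM).trans
      (le_prod_parityKernel (by linarith) (by linarith) fun v hv i => hweight _ _ _ ?_)
    simp [bitNoise, parentSum, walkBit]
  -- The indicator of an odd sum of the collider bits. It is rarely one, since the zero assignment
  -- alone has mass at least `3/4`.
  let g : (V → BitState.{u} N) → ℝ≥0∞ :=
    {ω | walkSum p Z ω N ≠ walkBit p ω 0}.indicator 1
  have hgZ : DependsOn g (Z : Set V) := by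
    intro ω ω' h
    have h1 := walkSum_add_congr (p := p) (ω := ω) (ω' := ω') h N
    have h2 : walkSum p Z ω N = walkBit p ω 0 ↔ walkSum p Z ω' N = walkBit p ω' 0 := by
      constructor
      · intro h3
        rw [h3, add_comm] at h1
        exact (add_right_cancel h1).symm
      · intro h3
        rw [h3, add_comm] at h1
        exact add_left_cancel h1
    simp [g, Set.indicator_apply, h2]
  have hodd : ∫⁻ ω, g ω * f ω ∂(Measure.pi μ) ≤ ENNReal.ofReal (1 / 4) := by
    have hg0 : g (fun _ => BitState.of 0) = 0 := by
      have : ∀ n, walkSum p Z (fun _ => BitState.of.{u} (0 : Fin (N + 1) → ZMod 2)) n = 0 := by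
        intro n
        induction n with
        | zero => simp [walkSum, walkBit]
        | succ n ih => simp [walkSum, walkBit, ih]
      simp [g, this, walkBit]
    have h1 : ∫⁻ ω, g ω * f ω ∂(Measure.pi μ) + ENNReal.ofReal (3 / 4) ≤ 1 := by
      calc ∫⁻ ω, g ω * f ω ∂(Measure.pi μ) + ENNReal.ofReal (3 / 4)
          ≤ ∫⁻ ω, g ω * f ω ∂(Measure.pi μ) +
            ∫⁻ ω, ({fun _ => BitState.of 0} : Set (V → BitState.{u} N)).indicator f ω
              ∂(Measure.pi μ) := by
            gcongr
            rw [lintegral_indicator (measurableSet_singleton _), lintegral_singleton,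
              Measure.pi_singleton]
            simpa [μ] using hzero
        _ = ∫⁻ ω, (g ω * f ω +
            ({fun _ => BitState.of 0} : Set (V → BitState.{u} N)).indicator f ω)
              ∂(Measure.pi μ) := (lintegral_add_left (measurable_of_countable _) _).symm
        _ ≤ ∫⁻ ω, f ω ∂(Measure.pi μ) := by
            refine lintegral_mono fun ω => ?_
            by_cases hω : ω = fun _ => BitState.of 0
            · simp [hω, hg0]
            · simp only [Set.mem_singleton_iff, hω, not_false_eq_true,
                Set.indicator_of_notMem, add_zero]
              exact mul_le_of_le_one_left' (Set.indicator_le_self' (fun _ _ => zero_le_one) ω)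
        _ = 1 := hf1
    refine ENNReal.le_of_add_le_add_right (ENNReal.ofReal_ne_top (r := 3 / 4)) (h1.trans ?_)
    rw [← ENNReal.ofReal_add (by norm_num) (by norm_num)]
    norm_num
  have hcond : ∀ ω, (∀ v, v ∉ Z → ω v = ω₁ v) →
      condDensity μ f {y} ({x} ∪ Z) ω * marginalDensity μ f Z ω ≤
        g ω * marginalDensity μ f Z ω + ENNReal.ofReal (1 / 4) * marginalDensity μ f Z ω := by
    intro ω hω
    rw [← add_mul]
    gcongr
    unfold condDensity
    -- If the collider sum is even, starting bit one and final bit zero contradict propagation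
    -- without noise, so the conditional density is at most `1/4`. If it is odd, the trivial bound
    -- one suffices. In total the adjustment functional is at most `1/2 < 3/4`.
    by_cases hpar : walkSum p Z ω N = walkBit p ω 0
    · refine le_add_left (ENNReal.div_le_of_le_mul ?_)
      have hupper : marginalDensity μ f ({y} ∪ ({x} ∪ Z)) ω ≤
          ENNReal.ofReal δ * ENNReal.ofReal k := by
        rw [← hk, ← lintegral_const]
        refine lintegral_mono fun z => ?_
        have hagree : ∀ v, v ∉ B → Function.updateFinset ω B z v = ω v := fun v hv => by
          simp [Function.updateFinset, hv]
        have hnoise : ∃ v i, IsInner p e v i ∧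
            bitNoise p e v i (Function.updateFinset ω B z) ≠ 0 := by
          by_contra! hcon
          have h1 := hw.walkBit_last hNZ hcon
          have h2 := walkSum_add_congr (p := p) (Z := Z) (ω := Function.updateFinset ω B z)
            (ω' := ω) (fun v hv => hagree v (by simp [hB, hv])) N
          have hyω : ω y = ω₁ y := hω y hyZ
          have hxω : ω x = ω₁ x := hω x hxZ
          have h3 : walkBit p (Function.updateFinset ω B z) N = 0 := by
            rw [walkBit_congr (ω' := ω₁), hbit₁ N (hN ▸ hxy.symm)]
            rw [hN, hagree y (by simp [hB]), hyω]
          have h4 : walkBit p (Function.updateFinset ω B z) 0 = 1 := by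
            rw [walkBit_congr (ω' := ω₁), hstart₁]
            rw [hw.start, hagree x (by simp [hB]), hxω]
          have h5 : walkBit p ω 0 = 1 := by
            rw [walkBit_congr (ω' := ω₁), hstart₁]
            rw [hw.start, hxω]
          rw [← h1, h3, hpar, h4, h5] at h2
          exact absurd h2 (by decide)
        obtain ⟨v, i, hi, hn⟩ := hnoise
        exact prod_parityKernel_le hη1 hδ1 (by simp) hi hn
      have hlower : ENNReal.ofReal (η ^ M) ≤ marginalDensity μ f ({x} ∪ Z) ω := by
        obtain ⟨ω', h1, h2⟩ := hw.exists_noiseless hxZ hNZ ω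
        refine le_trans ?_ (le_lmarginal_count (ω' := ω') f fun v hv => h1 v ?_)
        swap
        · rwa [Finset.mem_compl, not_not, Finset.mem_union, Finset.mem_singleton] at hv
        refine le_prod_parityKernel hη0.le hη1.2 fun v _ i => ?_
        by_cases hi : IsInner p e v i
        · exact le_trans (by linarith) (hweight _ _ _ (h2 v i hi))
        · unfold noiseWeight noiseProb
          rw [if_neg hi]
          split_ifs <;> linarith
      calc marginalDensity μ f ({y} ∪ ({x} ∪ Z)) ω ≤ ENNReal.ofReal δ * ENNReal.ofReal k := hupper
        _ = ENNReal.ofReal (δ * k) := (ENNReal.ofReal_mul hδ0.le).symm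
        _ ≤ ENNReal.ofReal (1 / 4 * η ^ M) := ENNReal.ofReal_le_ofReal (by linarith)
        _ = ENNReal.ofReal (1 / 4) * ENNReal.ofReal (η ^ M) := ENNReal.ofReal_mul (by norm_num)
        _ ≤ _ := by gcongr
    · have hg1 : g ω = 1 := by simp [g, hpar]
      rw [hg1]
      refine le_add_right (ENNReal.div_le_of_le_mul ?_)
      have hset : ({x} ∪ Z)ᶜ = {y} ∪ B := by
        ext v
        simp only [hB, Finset.mem_compl, Finset.mem_union, Finset.mem_singleton]
        by_cases hvy : v = y
        · simp [hvy, hxy.symm, hyZ]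
        · simp [hvy]
      rw [one_mul, marginalDensity, marginalDensity, hset,
        lmarginal_union μ f hfm (by simp [hB])]
      exact le_lmarginal_count _ fun _ _ => rfl
  have hadj_le : adjustmentDensity μ f {x} {y} Z ω₁ ≤
      ENNReal.ofReal (1 / 4) + ENNReal.ofReal (1 / 4) := by
    have hodd' : (∫⋯∫⁻_Z, (fun ω => g ω * marginalDensity μ f Z ω) ∂μ) ω₁ ≤
        ENNReal.ofReal (1 / 4) := by
      have h1 := lmarginal_mul_left (μ := μ) (s := Zᶜ) hfm (g := g) (by simpa using hgZ)
      have h2 := lmarginal_lmarginal_compl (μ := μ) (f := fun ω => g ω * f ω)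
        (measurable_of_countable _) Z
      rw [h1] at h2
      exact (congrFun h2 ω₁).trans_le hodd
    have hone : (∫⋯∫⁻_Z, marginalDensity μ f Z ∂μ) ω₁ = 1 :=
      (congrFun (lmarginal_lmarginal_compl (μ := μ) hfm Z) ω₁).trans hf1
    calc adjustmentDensity μ f {x} {y} Z ω₁
        ≤ ∫⁻ z, ((fun ω => g ω * marginalDensity μ f Z ω) (Function.updateFinset ω₁ Z z) +
            ENNReal.ofReal (1 / 4) * marginalDensity μ f Z (Function.updateFinset ω₁ Z z))
            ∂(Measure.pi fun i : Z => μ i) := by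
          refine lintegral_mono fun z => hcond _ fun v hv => ?_
          simp [Function.updateFinset, hv]
      _ = (∫⋯∫⁻_Z, (fun ω => g ω * marginalDensity μ f Z ω) ∂μ) ω₁ +
            ENNReal.ofReal (1 / 4) * (∫⋯∫⁻_Z, marginalDensity μ f Z ∂μ) ω₁ := by
          rw [lintegral_add_left (measurable_of_countable _),
            lintegral_const_mul _ (measurable_of_countable _)]
          rfl
      _ ≤ _ := by
          rw [hone, mul_one]
          gcongr
  rw [heq₁] at hdo
  have := hdo.trans hadj_le
  rw [← ENNReal.ofReal_add (by norm_num) (by norm_num),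
    ENNReal.ofReal_le_ofReal_iff (by norm_num)] at this
  norm_num at this

/-! ### Back-door blocking and the combination of adjustment sets -/

namespace DAG

variable {V : Type w} [Fintype V] [DecidableEq V] {D : DAG V}

/-- If a non-descendant `b` of `x` is connected to `y` given `T`, but no longer given `T` and `x`,
then `x` is an ancestor of `y` and `T` blocks the back-door connections from `x` to `y`. -/
lemma backdoor_of_separates {b x y : V} {T : Finset V} (hbx : b ≠ x) (hyx : y ≠ x) (hbT : b ∉ T)
    (hyT : y ∉ T) (hxb : ¬ D.IsAncestor x b) (hxT : ∀ t ∈ T, ¬ D.IsAncestor x t)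
    (hconn : D.MoralConn (D.ancestors (insert b (insert y T))) T b y)
    (hsep : ¬ D.MoralConn (D.ancestors (insert b (insert y (T ∪ {x})))) (T ∪ {x}) b y) :
    D.IsAncestor x y ∧
      ∀ a, D.Adj a x → ¬ D.MoralConn (D.ancestors ({x} ∪ {y} ∪ T)) ({x} ∪ T) a y := by
  set S := D.ancestors (insert b (insert y T)) with hS
  set S' := D.ancestors (insert b (insert y (T ∪ {x}))) with hS'
  have hSS' : S ⊆ S' := ancestors_mono (by grind)
  have hanc : ∀ c ∈ S, D.IsAncestor x c → D.IsAncestor c y := by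
    intro c hc hxc
    obtain ⟨t, ht, hct⟩ := mem_ancestors.1 hc
    simp only [Finset.mem_insert] at ht
    rcases ht with rfl | rfl | ht
    · exact absurd (hxc.trans hct) hxb
    · exact hct
    · exact absurd (hxc.trans hct) (hxT t ht)
  -- Here `m` is the last node before the connection first meets `x`, and `c` is the node whose
  -- family contains both.
  obtain ⟨m, hbm, -, -, c, hcS, hmc, hxc⟩ :
      ∃ m, D.MoralConn S' (T ∪ {x}) b m ∧ D.MoralAdj S T m x := by
    suffices ∀ t, D.MoralConn S T b t → D.MoralConn S' (T ∪ {x}) b t ∨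
        ∃ m, D.MoralConn S' (T ∪ {x}) b m ∧ D.MoralAdj S T m x from
      (this y hconn).resolve_left hsep
    intro t ht
    induction ht with
    | refl => exact .inl .refl
    | @tail t t' _ htt' ih =>
      rcases ih with ih | ih
      · by_cases ht' : t' = x
        · exact .inr ⟨t, ih, ht' ▸ htt'⟩
        · refine .inl (ih.tail ⟨ih.notMem (by simp [hbT, hbx]), by simp [htt'.2.1, ht'], ?_⟩)
          obtain ⟨c, hc, h⟩ := htt'.2.2
          exact ⟨c, hSS' hc, h⟩
      · exact .inr ih
  have hm : m ∉ T ∪ {x} := hbm.notMem (by simp [hbT, hbx])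
  have hxc' : D.IsAncestor x c := by
    rcases hxc with rfl | hxc
    · exact .refl
    · exact .single hxc
  have hcy := hanc c hcS hxc'
  refine ⟨hxc'.trans hcy, fun a hax hay => ?_⟩
  have hay' : D.MoralConn S' (T ∪ {x}) a y := by
    rw [Finset.union_comm {x} T] at hay
    exact hay.mono (ancestors_mono (by grind))
  have haC : a ∉ T ∪ {x} := hay'.symm.notMem (by simp [hyT, hyx])
  rcases hxc with rfl | hxc
  -- For `c = x`, the nodes `m` and `a` are both parents of `x` and hence moral-adjacent.
  · have hmx : D.Adj m x := hmc.resolve_left fun h => hm (by simp [h])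
    exact hsep ((hbm.tail ⟨hm, haC, x, hSS' hcS, .inr hmx, .inr hax⟩).trans hay')
  -- For a child `c` of `x`, the causal path from `c` to `y` avoids `T` and `x`, which contradicts
  -- separation whatever `a` is.
  · have hC : ∀ t, D.IsAncestor c t → t ∉ T ∪ {x} := by
      intro t hct ht
      rw [Finset.mem_union, Finset.mem_singleton] at ht
      rcases ht with ht | rfl
      · exact hxT t ht (hxc'.trans hct)
      · exact not_isAncestor_of_adj hxc hct
    have hcy' : D.MoralConn S' (T ∪ {x}) c y :=
      .of_isAncestor hcy
        (fun t ht => mem_ancestors_of_isAncestor ht (mem_ancestors_of_mem (by simp)))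
        fun t ht _ => hC t ht
    rcases hmc with rfl | hmc
    · exact hsep (hbm.trans hcy')
    · exact hsep ((hbm.tail (.of_adj hmc hm (hC c .refl) (hSS' hcS))).trans hcy')

/-- Completeness of the back-door criterion: no parent of `x` is connected to `y` given an
adjustment set for `(x, y)`. -/
lemma not_moralConn_of_isAdjustmentSet {x y a : V} {S C Z : Finset V}
    (h : IsAdjustmentSet.{u} D {x} {y} Z) (hS : S ⊆ D.ancestors (insert x (insert y Z)))
    (hZC : Z ⊆ C) (hx : x ∈ C) (ha : D.Adj a x) : ¬ D.MoralConn S C a y := by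
  intro hc
  obtain ⟨d, hd⟩ := Reach.of_moralConn hS hZC hx ha hc
  obtain ⟨N, p, e, hw, hp, -⟩ := hd.exists_isBackdoorWalk
  exact hw.not_isAdjustmentSet hp h

/-- A minimal adjustment set without descendants of `x` consists of ancestors of `x` and `y`. -/
lemma subset_ancestors_of_isMinimalAdjustmentSet {x y : V} {Z : Finset V}
    (h : IsMinimalAdjustmentSet.{u} D {x} {y} Z) (hxZ : ∀ z ∈ Z, ¬ D.IsAncestor x z) :
    Z ⊆ D.ancestors {x, y} := by
  obtain ⟨hadj, hmin⟩ := h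
  have hdisj := hadj.1
  set Z' := Z ∩ D.ancestors {x, y} with hZ'
  have hsub : Z' ⊆ Z := Finset.inter_subset_left
  suffices hZ'adj : IsAdjustmentSet.{u} D {x} {y} Z' by
    have : Z' = Z := by
      by_contra hne
      exact hmin Z' (Finset.ssubset_iff_subset_ne.2 ⟨hsub, hne⟩) hZ'adj
    rw [← this]
    exact Finset.inter_subset_right
  refine isAdjustmentSet_of_not_moralConn ?_ ?_ (hdisj.2.1.mono_right hsub) ?_ ?_
  · simpa [eq_comm] using hdisj.1
  · exact fun h => (by simpa using hdisj.2.2 : y ∉ Z) (hsub h)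
  · intro x' hx' z hz
    rw [Finset.mem_singleton.1 hx']
    exact hxZ z (hsub hz)
  · intro x' hx' a ha hc
    rw [Finset.mem_singleton.1 hx'] at ha
    have hS : D.ancestors ({x} ∪ {y} ∪ Z') ⊆ D.ancestors {x, y} := by
      intro v hv
      obtain ⟨t, ht, hvt⟩ := mem_ancestors.1 hv
      refine mem_ancestors_of_isAncestor hvt ?_
      simp only [Finset.mem_union, Finset.mem_singleton] at ht
      rcases ht with (rfl | rfl) | ht
      · exact mem_ancestors_of_mem (by simp)
      · exact mem_ancestors_of_mem (by simp)
      · exact (Finset.mem_inter.1 ht).2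
    -- The connection stays within the ancestors of `x` and `y`, where `Z'` and `Z` agree, so it
    -- avoids `Z` as well.
    have havoid : ∀ u ∉ {x} ∪ Z', u ∈ D.ancestors {x, y} → u ∉ {x} ∪ Z := by
      intro u hu huS hu'
      simp only [hZ', Finset.mem_union, Finset.mem_inter, Finset.mem_singleton] at hu hu'
      tauto
    have hmem : ∀ {u c}, c ∈ D.ancestors ({x} ∪ {y} ∪ Z') → (u = c ∨ D.Adj u c) →
        u ∈ D.ancestors {x, y} := by
      rintro u c hc (rfl | huc)
      · exact hS hc
      · exact mem_ancestors_of_isAncestor (.single huc) (hS hc)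
    refine not_moralConn_of_isAdjustmentSet hadj (S := D.ancestors ({x} ∪ {y} ∪ Z'))
      (C := {x} ∪ Z) (hS.trans (ancestors_mono (by grind))) Finset.subset_union_right (by simp)
      ha ?_
    refine Relation.ReflTransGen.mono (fun u v huv => ?_) _ _ hc
    obtain ⟨hu, hv, c, hcS, huc, hvc⟩ := huv
    exact ⟨havoid u hu (hmem hcS huc), havoid v hv (hmem hcS hvc), c, hcS, huc, hvc⟩

end DAG

theorem theorem3 {V : Type w} [Fintype V] [DecidableEq V] {Ω : V → Type u}
    [∀ v, MeasurableSpace (Ω v)] (μ : ∀ v, Measure (Ω v)) [∀ v, SigmaFinite (μ v)]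
    (M : CausalModel Ω μ)
    {k : ℕ} (hk : 1 ≤ k) (X : Fin k → V) (hX : Function.Injective X) (Y : V) (W : Finset V)
    (hXY : Disjoint (Finset.univ.image X) {Y}) (hXW : Disjoint (Finset.univ.image X) W)
    (hYW : Disjoint {Y} W)
    (hord : M.graph.IsCausalOrdering [W, Finset.univ.image X, {Y}])
    (Wi : Fin k → V) (hWi : ∀ i, Wi i ∈ W) (T : Fin k → Finset V)
    (hT : ∀ i, T i ⊆ (W \ Finset.univ.image Wi) ∪
      M.graph.nonDescendantsIn (Finset.univ.image X) (X i))
    (hdep : ∀ i, ¬ CondIndepDensity μ M.density {Wi i} {Y} (T i))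
    (hindep : ∀ i, CondIndepDensity μ M.density {Wi i} {Y} (T i ∪ {X i})) :
    M.graph.HasCausalEffect (Finset.univ.image X) {Y} ∧
      (∀ i, ∃ Z ⊆ T i, IsMinimalAdjustmentSet.{u} M.graph {X i} {Y} Z) ∧
      ∀ Z : Fin k → Finset V,
        (∀ i, Z i ⊆ T i ∧ IsMinimalAdjustmentSet.{u} M.graph {X i} {Y} (Z i)) →
          IsAdjustmentSet.{u} M.graph (Finset.univ.image X) {Y}
            (Finset.univ.biUnion Z \ Finset.univ.image X) := by
  classical
  set D := M.graph with hD
  set XS := Finset.univ.image X with hXS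
  have hWX : ∀ b ∈ W, ∀ a ∈ XS, ¬ D.IsAncestor a b := by
    simp only [DAG.IsCausalOrdering, List.pairwise_cons, List.mem_cons, List.not_mem_nil, or_false,
      forall_eq_or_imp, forall_eq, Finset.mem_singleton] at hord
    exact hord.1.1
  have hXmem : ∀ i, X i ∈ XS := fun i => Finset.mem_image_of_mem X (Finset.mem_univ i)
  have hYX : Y ∉ XS := by simpa using hXY
  have hYW' : Y ∉ W := by simpa using hYW
  have hWXS : ∀ v ∈ W, v ∉ XS := fun v hv hvX => Finset.disjoint_left.1 hXW hvX hv
  have hTmem : ∀ i, ∀ t ∈ T i, (t ∈ W ∧ t ∉ Finset.univ.image Wi) ∨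
      (t ∈ XS ∧ ¬ D.IsAncestor (X i) t) := by
    intro i t ht
    simpa [DAG.nonDescendantsIn, Finset.mem_union, Finset.mem_sdiff] using hT i ht
  have hXT : ∀ i, ∀ t ∈ T i, ¬ D.IsAncestor (X i) t := fun i t ht =>
    (hTmem i t ht).elim (fun h => hWX t h.1 _ (hXmem i)) fun h => h.2
  have hYT : ∀ i, Y ∉ T i := fun i h => (hTmem i Y h).elim (fun h => hYW' h.1) fun h => hYX h.1
  have hXiT : ∀ i, X i ∉ T i := fun i h => hXT i _ h .refl
  have hWiT : ∀ i, Wi i ∉ T i := fun i h => (hTmem i _ h).elim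
    (fun h => h.2 (Finset.mem_image_of_mem Wi (Finset.mem_univ i)))
    fun h => hWXS _ (hWi i) h.1
  have hWiX : ∀ i, Wi i ≠ X i := fun i h => hWXS _ (hWi i) (h ▸ hXmem i)
  have hWiY : ∀ i, Wi i ≠ Y := fun i h => hYW' (h ▸ hWi i)
  have hYXi : ∀ i, Y ≠ X i := fun i h => hYX (h ▸ hXmem i)
  have key : ∀ i, D.IsAncestor (X i) Y ∧ ∀ a, D.Adj a (X i) →
      ¬ D.MoralConn (D.ancestors ({X i} ∪ {Y} ∪ T i)) ({X i} ∪ T i) a Y := by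
    intro i
    refine DAG.backdoor_of_separates (hWiX i) (hYXi i) (hWiT i) (hYT i)
      (hWX _ (hWi i) _ (hXmem i)) (hXT i) ?_ ?_
    · by_contra hc
      exact hdep i (M.compatible.condIndepDensity (hYT i) hc)
    · have hsep := M.faithful {Wi i} {Y} (T i ∪ {X i}) (by simpa using hWiY i)
        (by simp [hWiT i, hWiX i]) (by simp [hYT i, hYXi i]) (hindep i)
      exact hsep.not_moralConn (hWiY i) subset_rfl
  refine ⟨⟨X ⟨0, hk⟩, hXmem _, Y, Finset.mem_singleton_self Y, (key _).1⟩, fun i => ?_,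
    fun Z hZ => ?_⟩
  · have hTadj : IsAdjustmentSet.{u} D {X i} {Y} (T i) := by
      refine isAdjustmentSet_of_not_moralConn (by simpa using hYXi i) (hYT i)
        (by simpa using hXiT i) ?_ ?_
      · intro x hx
        rw [Finset.mem_singleton.1 hx]
        exact hXT i
      · intro x hx
        rw [Finset.mem_singleton.1 hx]
        exact (key i).2
    obtain ⟨Z, hZT, hZ⟩ := exists_minimal_le_of_wellFoundedLT
      (fun Z => IsAdjustmentSet.{u} D {X i} {Y} Z) (T i) hTadj
    exact ⟨Z, hZT, hZ.1, fun Z' hZ' h => hZ.not_prop_of_lt hZ' h⟩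
  · have hZY : ∀ i, Z i ⊆ D.ancestors {Y} := by
      intro i z hz
      have := DAG.subset_ancestors_of_isMinimalAdjustmentSet (hZ i).2
        (fun z hz => hXT i z ((hZ i).1 hz)) hz
      obtain ⟨t, ht, hzt⟩ := DAG.mem_ancestors.1 this
      rw [Finset.mem_insert, Finset.mem_singleton] at ht
      refine DAG.mem_ancestors.2 ⟨Y, Finset.mem_singleton_self Y, ?_⟩
      rcases ht with rfl | rfl
      · exact hzt.trans (key i).1
      · exact hzt
    set ZU := Finset.univ.biUnion Z \ XS with hZU
    have hZUW : ∀ z ∈ ZU, z ∈ W := by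
      intro z hz
      obtain ⟨hz, hzX⟩ := Finset.mem_sdiff.1 hz
      obtain ⟨i, -, hzi⟩ := Finset.mem_biUnion.1 hz
      exact (hTmem i z ((hZ i).1 hzi)).elim (fun h => h.1) fun h => absurd h.1 hzX
    refine isAdjustmentSet_of_not_moralConn hYX (fun h => hYW' (hZUW Y h)) Finset.disjoint_sdiff
      (fun x hx z hz => hWX z (hZUW z hz) x hx) ?_
    intro x hx a hax
    obtain ⟨i, -, rfl⟩ := Finset.mem_image.1 hx
    refine DAG.not_moralConn_of_isAdjustmentSet (hZ i).2.1 ?_ ?_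
      (Finset.mem_union_left _ (hXmem i)) hax
    -- All of `X`, `Y` and the union lie in the ancestors of `Y`, so the moral graph is not larger
    -- than the one for `X i`.
    · refine Finset.Subset.trans ?_ (DAG.ancestors_mono (A := {Y}) (by simp))
      intro v hv
      obtain ⟨t, ht, hvt⟩ := DAG.mem_ancestors.1 hv
      refine DAG.mem_ancestors_of_isAncestor hvt ?_
      rw [Finset.mem_union, Finset.mem_union] at ht
      rcases ht with (ht | ht) | ht
      · obtain ⟨j, -, rfl⟩ := Finset.mem_image.1 ht
        exact DAG.mem_ancestors.2 ⟨Y, Finset.mem_singleton_self Y, (key j).1⟩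
      · exact DAG.mem_ancestors_of_mem ht
      · obtain ⟨j, -, hj⟩ := Finset.mem_biUnion.1 (Finset.mem_sdiff.1 ht).1
        exact hZY j hj
    -- Members of `Z i` that lie in `X` are dropped from the union but are still removed from the
    -- graph as part of `X`.
    · intro z hz
      by_cases hzX : z ∈ XS
      · exact Finset.mem_union_left _ hzX
      · exact Finset.mem_union_right _
          (Finset.mem_sdiff.2 ⟨Finset.mem_biUnion.2 ⟨i, Finset.mem_univ i, hz⟩, hzX⟩)
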